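/- **Coherence for (op)lax symmetric monoidal functors.** *Formal morphisms.* For a set $T$, let $\mathcal F(T)$ be the free symmetric monoidal category on $T$ (objects: parenthesized words in elements of $T$ and a unit $I$; morphisms: formal composites of expanded instances of associators, unitors and symmetries, modulo the axioms of a symmetric monoidal category). Let $F_T\colon \mathcal F(T)\to \mathcal L(T)$ be the free lax symmetric monoidal functor on $T$. The objects of $\mathcal L(T)$ are parenthesized words in the expressions $F(w)$, $w\in\mathcal F(T)$, and a unit $I$. Its morphisms are formal composites of expanded instances of associators, unitors and symmetries and of the generators $F(f)\colon F(w)\to F(w')$ (for $f\colon w\to w'$ in $\mathcal F(T)$), $i\colon I\to F(I)$ and $m\colon F(w)\otimes F(w')\to F(w\otimes w')$, modulo the axioms making $\mathcal L(T)$ a symmetric monoidal category and $F_T$ a lax symmetric monoidal functor. For a lax symmetric monoidal functor $F\colon \mathcal C\to\mathcal D$ between symmetric monoidal categories, evaluation gives a strict symmetric monoidal functor $\mathcal L(\mathrm{ob}\,\mathcal C)\to\mathcal D$. A morphism $\phi\colon V\to V'$ of $\mathcal L(T)$ has an *underlying permutation* $P(\phi)$, a bijection from the positions of the letters (elements of $T$)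 in $V$ to those in $V'$, and a *supporting map* $U(\phi)\colon \underline k\to\underline k'$, where $V$ and $V'$ contain $k$ and $k'$ expressions $F(\dots)$ (the "blocks"). Both respect composition. Symmetries act on positions and blocks by the corresponding block transpositions; associators and unitors act as identities; $F(f)$ acts as the identity on blocks and as the permutation underlying $f$ on letters; $i$ and $m$ act as the identity on letters, and on blocks as the insertion of a new block and the merging of two adjacent blocks. *Diagrams.* A diagram in $\mathcal D$ is *formal* for $F$ if it lifts along $\mathcal L(\mathrm{ob}\,\mathcal C)\to\mathcal D$. It is *expected to commute* if it has such a lift in which any two parallel composites have the same supporting maps and the same underlying permutations. **Theorem.** 1. Every formal diagram of a lax symmetric monoidal functor that is expected to commute commutes: any two parallel composites in it are equal. 2. The same holds for oplax symmetric monoidal functors, with formal morphisms now taken in $\mathcal L(\mathrm{ob}\,\mathcal C)^{\mathrm{op}}$ (so that $i$ and $m$ point the other way). 3. Let $X_1,\dots,X_n$ ($n\ge 0$) be distinct elements of $T$, and let $W\in\mathcal L(T)$ be an object in which each $X_i$ occurs exactly once and no other element of $T$ occurs. Let $\mathbf{Fin}$ be the category with objects $\underline n=\{1,\dots,n\}$,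 $n\ge 0$, and all maps of finite sets. On the connected component of $W$ in $\mathcal L(T)$, sending $V$ to the map $\underline n\to\underline k$ that takes $\ell$ to the block of $V$ containing $X_\ell$, and $\phi$ to $U(\phi)$, defines a functor (the supporting set functor) to the comma category $(\underline n\downarrow\mathbf{Fin})$, and this functor is an equivalence of categories. Likewise, the opposite functor, from the opposite of that component to $(\underline n\downarrow\mathbf{Fin})^{\mathrm{op}}$, is an equivalence. -/

import Mathlib

open CategoryTheory MonoidalCategory

universe u v u₁ v₁ u₂ v₂ w₁ w₂

namespace SymCoherence

/-! ### Symmetric monoidal categories given by generators and relations -/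

/-- Parenthesized words in the letters `A` and a formal unit. -/
inductive Word (A : Type u) : Type u
  | atom : A → Word A
  | unit : Word A
  | tensor : Word A → Word A → Word A

/-- Formal composites of expanded instances of the structure maps of a symmetric monoidal category
and of the generators `G`. -/
inductive Pre {A : Type u} (G : Word A → Word A → Type v) : Word A → Word A → Type (max u v)
  | gen {V W : Word A} (g : G V W) : Pre G V W
  | id (V : Word A) : Pre G V V
  | comp {V W Z : Word A} (f : Pre G V W) (g : Pre G W Z) : Pre G V Z
  | whiskerLeft (V : Word A) {W Z : Word A} (f : Pre G W Z) : Pre G (V.tensor W) (V.tensor Z)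
  | whiskerRight {V W : Word A} (f : Pre G V W) (Z : Word A) : Pre G (V.tensor Z) (W.tensor Z)
  | assocHom (V W Z : Word A) : Pre G ((V.tensor W).tensor Z) (V.tensor (W.tensor Z))
  | assocInv (V W Z : Word A) : Pre G (V.tensor (W.tensor Z)) ((V.tensor W).tensor Z)
  | leftHom (V : Word A) : Pre G (Word.unit.tensor V) V
  | leftInv (V : Word A) : Pre G V (Word.unit.tensor V)
  | rightHom (V : Word A) : Pre G (V.tensor Word.unit) V
  | rightInv (V : Word A) : Pre G V (V.tensor Word.unit)
  | braid (V W : Word A) : Pre G (V.tensor W) (W.tensor V)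

/-- The congruence on formal composites generated by the axioms of a symmetric monoidal category
and the additional relations `R`. -/
inductive PreRel {A : Type u} (G : Word A → Word A → Type v)
    (R : ∀ ⦃V W : Word A⦄, Pre G V W → Pre G V W → Prop) :
    ∀ {V W : Word A}, Pre G V W → Pre G V W → Prop
  | rel {V W} {f g : Pre G V W} : R f g → PreRel G R f g
  | refl {V W} (f : Pre G V W) : PreRel G R f f
  | symm {V W} {f g : Pre G V W} : PreRel G R f g → PreRel G R g f
  | trans {V W} {f g h : Pre G V W} : PreRel G R f g → PreRel G R g h → PreRel G R f h
  | comp {V W Z} {f f' : Pre G V W} {g g' : Pre G W Z} :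
      PreRel G R f f' → PreRel G R g g' → PreRel G R (f.comp g) (f'.comp g')
  | whiskerLeft (V) {W Z} {f f' : Pre G W Z} :
      PreRel G R f f' → PreRel G R (f.whiskerLeft V) (f'.whiskerLeft V)
  | whiskerRight {V W} {f f' : Pre G V W} (Z) :
      PreRel G R f f' → PreRel G R (f.whiskerRight Z) (f'.whiskerRight Z)
  | id_comp {V W} (f : Pre G V W) : PreRel G R ((Pre.id V).comp f) f
  | comp_id {V W} (f : Pre G V W) : PreRel G R (f.comp (Pre.id W)) f
  | assoc {V W Y Z} (f : Pre G V W) (g : Pre G W Y) (h : Pre G Y Z) :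
      PreRel G R ((f.comp g).comp h) (f.comp (g.comp h))
  | whiskerLeft_id (V W) : PreRel G R ((Pre.id W).whiskerLeft V) (Pre.id (V.tensor W))
  | whiskerLeft_comp (V) {W Y Z} (f : Pre G W Y) (g : Pre G Y Z) :
      PreRel G R ((f.comp g).whiskerLeft V) ((f.whiskerLeft V).comp (g.whiskerLeft V))
  | id_whiskerRight (V W) : PreRel G R ((Pre.id V).whiskerRight W) (Pre.id (V.tensor W))
  | comp_whiskerRight {V W Y} (f : Pre G V W) (g : Pre G W Y) (Z) :
      PreRel G R ((f.comp g).whiskerRight Z) ((f.whiskerRight Z).comp (g.whiskerRight Z))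
  | whisker_exchange {V W Y Z} (f : Pre G V W) (g : Pre G Y Z) :
      PreRel G R ((g.whiskerLeft V).comp (f.whiskerRight Z))
        ((f.whiskerRight Y).comp (g.whiskerLeft W))
  | assocHom_inv (V W Z) :
      PreRel G R ((Pre.assocHom V W Z).comp (Pre.assocInv V W Z)) (Pre.id _)
  | assocInv_hom (V W Z) :
      PreRel G R ((Pre.assocInv V W Z).comp (Pre.assocHom V W Z)) (Pre.id _)
  | assoc_naturality_left {V V'} (f : Pre G V V') (W Z) :
      PreRel G R (((f.whiskerRight W).whiskerRight Z).comp (Pre.assocHom V' W Z))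
        ((Pre.assocHom V W Z).comp (f.whiskerRight (W.tensor Z)))
  | assoc_naturality_middle (V) {W W'} (f : Pre G W W') (Z) :
      PreRel G R (((f.whiskerLeft V).whiskerRight Z).comp (Pre.assocHom V W' Z))
        ((Pre.assocHom V W Z).comp ((f.whiskerRight Z).whiskerLeft V))
  | assoc_naturality_right (V W) {Z Z'} (f : Pre G Z Z') :
      PreRel G R ((f.whiskerLeft (V.tensor W)).comp (Pre.assocHom V W Z'))
        ((Pre.assocHom V W Z).comp ((f.whiskerLeft W).whiskerLeft V))
  | leftHom_inv (V) : PreRel G R ((Pre.leftHom V).comp (Pre.leftInv V)) (Pre.id _)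
  | leftInv_hom (V) : PreRel G R ((Pre.leftInv V).comp (Pre.leftHom V)) (Pre.id _)
  | left_naturality {V W} (f : Pre G V W) :
      PreRel G R ((f.whiskerLeft Word.unit).comp (Pre.leftHom W)) ((Pre.leftHom V).comp f)
  | rightHom_inv (V) : PreRel G R ((Pre.rightHom V).comp (Pre.rightInv V)) (Pre.id _)
  | rightInv_hom (V) : PreRel G R ((Pre.rightInv V).comp (Pre.rightHom V)) (Pre.id _)
  | right_naturality {V W} (f : Pre G V W) :
      PreRel G R ((f.whiskerRight Word.unit).comp (Pre.rightHom W)) ((Pre.rightHom V).comp f)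
  | pentagon (V W Y Z) :
      PreRel G R
        (((Pre.assocHom V W Y).whiskerRight Z).comp
          ((Pre.assocHom V (W.tensor Y) Z).comp ((Pre.assocHom W Y Z).whiskerLeft V)))
        ((Pre.assocHom (V.tensor W) Y Z).comp (Pre.assocHom V W (Y.tensor Z)))
  | triangle (V W) :
      PreRel G R ((Pre.assocHom V Word.unit W).comp ((Pre.leftHom W).whiskerLeft V))
        ((Pre.rightHom V).whiskerRight W)
  | braid_naturality_right (V) {W Z} (f : Pre G W Z) :
      PreRel G R ((f.whiskerLeft V).comp (Pre.braid V Z)) ((Pre.braid V W).comp (f.whiskerRight V))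
  | braid_naturality_left {V W} (f : Pre G V W) (Z) :
      PreRel G R ((f.whiskerRight Z).comp (Pre.braid W Z)) ((Pre.braid V Z).comp (f.whiskerLeft Z))
  | braid_symm (V W) : PreRel G R ((Pre.braid V W).comp (Pre.braid W V)) (Pre.id _)
  | braid_unit (V) :
      PreRel G R ((Pre.braid V Word.unit).comp (Pre.leftHom V)) (Pre.rightHom V)
  | hexagon (V W Z) :
      PreRel G R
        ((Pre.assocHom V W Z).comp ((Pre.braid V (W.tensor Z)).comp (Pre.assocHom W Z V)))
        (((Pre.braid V W).whiskerRight Z).comp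
          ((Pre.assocHom W V Z).comp ((Pre.braid V Z).whiskerLeft W)))

section Presented

/-- The symmetric monoidal category presented by the atoms `A`, the generators `G` and the
relations `R`; its objects are the words in `A`. -/
def Presented {A : Type u} (G : Word A → Word A → Type v)
    (_R : ∀ ⦃V W : Word A⦄, Pre G V W → Pre G V W → Prop) : Type u := Word A

variable {A : Type u} {G : Word A → Word A → Type v}
  {R : ∀ ⦃V W : Word A⦄, Pre G V W → Pre G V W → Prop}

/-- Formal composites up to the relations. -/
def preSetoid (R : ∀ ⦃V W : Word A⦄, Pre G V W → Pre G V W → Prop) (V W : Word A) :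
    Setoid (Pre G V W) :=
  ⟨PreRel G R, PreRel.refl, PreRel.symm, PreRel.trans⟩

instance : Category.{max u v} (Presented G R) where
  Hom V W := Quotient (preSetoid R V W)
  id V := Quotient.mk _ (Pre.id V)
  comp := Quotient.map₂ Pre.comp (fun _ _ hf _ _ hg => PreRel.comp hf hg)
  id_comp := by rintro V W ⟨f⟩; exact Quotient.sound (PreRel.id_comp f)
  comp_id := by rintro V W ⟨f⟩; exact Quotient.sound (PreRel.comp_id f)
  assoc := by rintro V W Y Z ⟨f⟩ ⟨g⟩ ⟨h⟩; exact Quotient.sound (PreRel.assoc f g h)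

namespace Presented

/-- A word, as an object of the presented category. -/
abbrev of (V : Word A) : Presented G R := V

/-- The morphism represented by a formal composite. -/
def mk {V W : Word A} (f : Pre G V W) : (of V : Presented G R) ⟶ of W :=
  Quotient.mk _ f

theorem mk_surjective {V W : Presented G R} (f : V ⟶ W) :
    ∃ p : Pre G V W, (mk p : (of V : Presented G R) ⟶ of W) = f := Quotient.exists_rep f

theorem sound {V W : Word A} {f g : Pre G V W} (h : PreRel G R f g) :
    (mk f : (of V : Presented G R) ⟶ of W) = mk g :=
  Quotient.sound h

/-- Tensoring a morphism with an object on the left. -/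
def wL (V : Presented G R) {W Z : Presented G R} (f : W ⟶ Z) :
    (of (Word.tensor V W) : Presented G R) ⟶ of (Word.tensor V Z) :=
  Quotient.map (fun p => Pre.whiskerLeft V p) (fun _ _ h => PreRel.whiskerLeft V h) f

/-- Tensoring a morphism with an object on the right. -/
def wR {V W : Presented G R} (f : V ⟶ W) (Z : Presented G R) :
    (of (Word.tensor V Z) : Presented G R) ⟶ of (Word.tensor W Z) :=
  Quotient.map (fun p => Pre.whiskerRight p Z) (fun _ _ h => PreRel.whiskerRight Z h) f

theorem wL_comp (V : Presented G R) {W Y Z : Presented G R} (f : W ⟶ Y) (g : Y ⟶ Z) :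
    wL V (f ≫ g) = wL V f ≫ wL V g := by
  obtain ⟨f⟩ := f; obtain ⟨g⟩ := g; exact Quotient.sound (PreRel.whiskerLeft_comp V f g)

theorem wR_comp {V W Y : Presented G R} (f : V ⟶ W) (g : W ⟶ Y) (Z : Presented G R) :
    wR (f ≫ g) Z = wR f Z ≫ wR g Z := by
  obtain ⟨f⟩ := f; obtain ⟨g⟩ := g; exact Quotient.sound (PreRel.comp_whiskerRight f g Z)

theorem w_exchange {V W Y Z : Presented G R} (f : V ⟶ W) (g : Y ⟶ Z) :
    wL V g ≫ wR f Z = wR f Y ≫ wL W g := by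
  obtain ⟨f⟩ := f; obtain ⟨g⟩ := g; exact Quotient.sound (PreRel.whisker_exchange f g)

instance : MonoidalCategoryStruct (Presented G R) where
  tensorObj V W := Word.tensor V W
  tensorUnit := Word.unit
  whiskerLeft V _ _ f := wL V f
  whiskerRight f Z := wR f Z
  tensorHom {_ W Y _} f g := wR f Y ≫ wL W g
  associator V W Z :=
    ⟨mk (Pre.assocHom V W Z), mk (Pre.assocInv V W Z),
      sound (PreRel.assocHom_inv V W Z), sound (PreRel.assocInv_hom V W Z)⟩
  leftUnitor V :=
    ⟨mk (Pre.leftHom V), mk (Pre.leftInv V),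
      sound (PreRel.leftHom_inv V), sound (PreRel.leftInv_hom V)⟩
  rightUnitor V :=
    ⟨mk (Pre.rightHom V), mk (Pre.rightInv V),
      sound (PreRel.rightHom_inv V), sound (PreRel.rightInv_hom V)⟩

theorem whiskerLeft_comp' (V : Presented G R) {W Y Z : Presented G R} (f : W ⟶ Y) (g : Y ⟶ Z) :
    V ◁ (f ≫ g) = V ◁ f ≫ V ◁ g := wL_comp V f g

theorem comp_whiskerRight' {V W Y : Presented G R} (f : V ⟶ W) (g : W ⟶ Y) (Z : Presented G R) :
    (f ≫ g) ▷ Z = f ▷ Z ≫ g ▷ Z := wR_comp f g Z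

theorem whisker_exchange' {V W Y Z : Presented G R} (f : V ⟶ W) (g : Y ⟶ Z) :
    V ◁ g ≫ f ▷ Z = f ▷ Y ≫ W ◁ g := w_exchange f g

theorem tensorHom_def' {V W Y Z : Presented G R} (f : V ⟶ W) (g : Y ⟶ Z) :
    f ⊗ₘ g = f ▷ Y ≫ W ◁ g := rfl

theorem whiskerLeft_id' (V W : Presented G R) : V ◁ 𝟙 W = 𝟙 (V ⊗ W) :=
  Quotient.sound (PreRel.whiskerLeft_id V W)

theorem id_whiskerRight' (V W : Presented G R) : 𝟙 V ▷ W = 𝟙 (V ⊗ W) :=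
  Quotient.sound (PreRel.id_whiskerRight V W)

theorem assoc_left {V V' : Presented G R} (f : V ⟶ V') (W Z : Presented G R) :
    (f ▷ W) ▷ Z ≫ (α_ V' W Z).hom = (α_ V W Z).hom ≫ f ▷ (W ⊗ Z) := by
  obtain ⟨f⟩ := f; exact Quotient.sound (PreRel.assoc_naturality_left f W Z)

theorem assoc_middle (V : Presented G R) {W W' : Presented G R} (f : W ⟶ W')
    (Z : Presented G R) :
    (V ◁ f) ▷ Z ≫ (α_ V W' Z).hom = (α_ V W Z).hom ≫ V ◁ (f ▷ Z) := by
  obtain ⟨f⟩ := f; exact Quotient.sound (PreRel.assoc_naturality_middle V f Z)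

theorem assoc_right (V W : Presented G R) {Z Z' : Presented G R} (f : Z ⟶ Z') :
    (V ⊗ W) ◁ f ≫ (α_ V W Z').hom = (α_ V W Z).hom ≫ V ◁ (W ◁ f) := by
  obtain ⟨f⟩ := f; exact Quotient.sound (PreRel.assoc_naturality_right V W f)

instance : MonoidalCategory (Presented G R) where
  tensorHom_def _ _ := rfl
  id_tensorHom_id V W := by
    rw [tensorHom_def', id_whiskerRight', whiskerLeft_id', Category.id_comp]
  tensorHom_comp_tensorHom f₁ f₂ g₁ g₂ := by
    simp only [tensorHom_def', comp_whiskerRight', whiskerLeft_comp', Category.assoc]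
    rw [← Category.assoc (_ ◁ f₂), whisker_exchange', Category.assoc]
  whiskerLeft_id := whiskerLeft_id'
  id_whiskerRight := id_whiskerRight'
  associator_naturality f₁ f₂ f₃ := by
    simp only [tensorHom_def', comp_whiskerRight', whiskerLeft_comp', Category.assoc]
    rw [assoc_right, ← Category.assoc (_ ▷ _) (Iso.hom _), assoc_middle, Category.assoc,
      ← Category.assoc _ (Iso.hom _), assoc_left, Category.assoc]
  leftUnitor_naturality f := by
    obtain ⟨f⟩ := f; exact Quotient.sound (PreRel.left_naturality f)
  rightUnitor_naturality f := by
    obtain ⟨f⟩ := f; exact Quotient.sound (PreRel.right_naturality f)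
  pentagon V W Y Z := Quotient.sound (PreRel.pentagon V W Y Z)
  triangle V W := Quotient.sound (PreRel.triangle V W)

/-- The symmetry isomorphism. -/
def braidIso (V W : Presented G R) : V ⊗ W ≅ W ⊗ V :=
  ⟨mk (Pre.braid V W), mk (Pre.braid W V),
    sound (PreRel.braid_symm V W), sound (PreRel.braid_symm W V)⟩

theorem braidIso_symm (V W : Presented G R) : (braidIso V W).symm = braidIso W V := rfl

theorem hexagon' (V W Z : Presented G R) :
    (α_ V W Z).hom ≫ (braidIso V (W ⊗ Z)).hom ≫ (α_ W Z V).hom =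
      (braidIso V W).hom ▷ Z ≫ (α_ W V Z).hom ≫ W ◁ (braidIso V Z).hom :=
  Quotient.sound (PreRel.hexagon V W Z)

instance : SymmetricCategory (Presented G R) where
  braiding := braidIso
  braiding_naturality_right V _ _ f := by
    obtain ⟨f⟩ := f; exact Quotient.sound (PreRel.braid_naturality_right V f)
  braiding_naturality_left f Z := by
    obtain ⟨f⟩ := f; exact Quotient.sound (PreRel.braid_naturality_left f Z)
  hexagon_forward := hexagon'
  hexagon_reverse V W Z := by
    have h : (α_ Z V W ≪≫ braidIso Z (V ⊗ W) ≪≫ α_ V W Z) =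
        (whiskerRightIso (braidIso Z V) W ≪≫ α_ V Z W ≪≫ whiskerLeftIso V (braidIso Z W)) :=
      Iso.ext (hexagon' Z V W)
    have h' := congrArg Iso.inv h
    simp only [Iso.trans_inv, Category.assoc] at h'
    exact h'
  symmetry V W := (braidIso V W).hom_inv_id


section Lift

variable {D : Type u₂} [Category.{v₂} D] [MonoidalCategory D] [SymmetricCategory D]

/-- The value of a word in a monoidal category, given the values of the atoms. -/
def evalObj (a : A → D) : Word A → D
  | .atom x => a x
  | .unit => 𝟙_ D
  | .tensor V W => evalObj a V ⊗ evalObj a W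

/-- The value of a formal composite, given the values of the generators. -/
def evalPre (a : A → D) (g : ∀ {V W}, G V W → (evalObj a V ⟶ evalObj a W)) :
    ∀ {V W : Word A}, Pre G V W → (evalObj a V ⟶ evalObj a W)
  | _, _, .gen x => g x
  | _, _, .id _ => 𝟙 _
  | _, _, .comp f h => evalPre a g f ≫ evalPre a g h
  | _, _, .whiskerLeft V f => evalObj a V ◁ evalPre a g f
  | _, _, .whiskerRight f Z => evalPre a g f ▷ evalObj a Z
  | _, _, .assocHom _ _ _ => (α_ _ _ _).hom
  | _, _, .assocInv _ _ _ => (α_ _ _ _).inv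
  | _, _, .leftHom _ => (λ_ _).hom
  | _, _, .leftInv _ => (λ_ _).inv
  | _, _, .rightHom _ => (ρ_ _).hom
  | _, _, .rightInv _ => (ρ_ _).inv
  | _, _, .braid _ _ => (β_ _ _).hom

theorem evalPre_congr (a : A → D) (g : ∀ {V W}, G V W → (evalObj a V ⟶ evalObj a W))
    (hR : ∀ {V W} {p q : Pre G V W}, R p q → evalPre a g p = evalPre a g q)
    {V W : Word A} {p q : Pre G V W} (h : PreRel G R p q) : evalPre a g p = evalPre a g q := by
  induction h with
  | rel h => exact hR h
  | refl => rfl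
  | symm _ ih => exact ih.symm
  | trans _ _ ih ih' => exact ih.trans ih'
  | comp _ _ ih ih' => simp only [evalPre, ih, ih']
  | whiskerLeft V _ ih => exact congrArg (fun k => evalObj a V ◁ k) ih
  | whiskerRight Z _ ih => exact congrArg (fun k => k ▷ evalObj a Z) ih
  | whisker_exchange => exact whisker_exchange _ _
  | hexagon => exact BraidedCategory.hexagon_forward _ _ _
  | _ => simp [evalPre, evalObj]

/-- The strict symmetric monoidal functor out of a presented symmetric monoidal category that is
determined by the values of the atoms and of the generators. -/
def lift (a : A → D) (g : ∀ {V W}, G V W → (evalObj a V ⟶ evalObj a W))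
    (hR : ∀ {V W} {p q : Pre G V W}, R p q → evalPre a g p = evalPre a g q) :
    Presented G R ⥤ D where
  obj V := evalObj a V
  map {V W} f := Quotient.lift (fun p : Pre G V W => evalPre a g p)
    (fun _ _ h => evalPre_congr a g hR h) f
  map_id _ := rfl
  map_comp := by rintro V W Z ⟨f⟩ ⟨h⟩; rfl

end Lift

end Presented

end Presented

/-! ### Free symmetric monoidal categories and free lax symmetric monoidal functors -/

section Free

/-- The free symmetric monoidal category on a set `T`: no generators or relations beyond the
symmetric monoidal structure. -/
abbrev FreeSym (T : Type u) : Type u :=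
  Presented (A := T) (fun _ _ => PEmpty.{u + 1}) (fun _ _ _ _ => False)

/-- The strict symmetric monoidal functor determined by the values of the letters. -/
def symEval {C : Type u₁} [Category.{v₁} C] [MonoidalCategory C] [SymmetricCategory C]
    {T : Type u} (x : T → C) : FreeSym T ⥤ C :=
  Presented.lift x (fun e => e.elim) (fun h => h.elim)

/-- Generators of the target of the free lax symmetric monoidal functor on `T`. The atoms are the
formal expressions `F(w)`, for `w` a word in the free symmetric monoidal category on `T`. -/
inductive LaxGen (T : Type u) : Word (FreeSym T) → Word (FreeSym T) → Type u
  /-- `F(f) : F(w) ⟶ F(w')` for each morphism `f` of the free symmetric monoidal category -/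
  | map {w w' : FreeSym T} (f : w ⟶ w') : LaxGen T (.atom w) (.atom w')
  /-- the unit map `I ⟶ F(I)` -/
  | unit : LaxGen T .unit (.atom (𝟙_ (FreeSym T)))
  /-- the composition map `F(w) ⊗ F(w') ⟶ F(w ⊗ w')` -/
  | mul (w w' : FreeSym T) : LaxGen T (.tensor (.atom w) (.atom w')) (.atom (w ⊗ w'))

/-- Relations in the target of the free lax symmetric monoidal functor on `T`: the expression `F`
is a functor, and the unit and composition maps make it lax symmetric monoidal. -/
inductive LaxRel (T : Type u) : ∀ ⦃V W : Word (FreeSym T)⦄,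
    Pre (LaxGen T) V W → Pre (LaxGen T) V W → Prop
  | map_id (w : FreeSym T) : LaxRel T (.gen (.map (𝟙 w))) (.id _)
  | map_comp {w w' w'' : FreeSym T} (f : w ⟶ w') (g : w' ⟶ w'') :
      LaxRel T (.gen (.map (f ≫ g))) (.comp (.gen (.map f)) (.gen (.map g)))
  | mul_left {w w' : FreeSym T} (f : w ⟶ w') (z : FreeSym T) :
      LaxRel T (.comp (.whiskerRight (.gen (.map f)) _) (.gen (.mul w' z)))
        (.comp (.gen (.mul w z)) (.gen (.map (f ▷ z))))
  | mul_right (z : FreeSym T) {w w' : FreeSym T} (f : w ⟶ w') :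
      LaxRel T (.comp (.whiskerLeft _ (.gen (.map f))) (.gen (.mul z w')))
        (.comp (.gen (.mul z w)) (.gen (.map (z ◁ f))))
  | unit_left (w : FreeSym T) :
      LaxRel T (.leftHom _)
        (.comp (.whiskerRight (.gen .unit) _) (.comp (.gen (.mul _ w)) (.gen (.map (λ_ w).hom))))
  | unit_right (w : FreeSym T) :
      LaxRel T (.rightHom _)
        (.comp (.whiskerLeft _ (.gen .unit)) (.comp (.gen (.mul w _)) (.gen (.map (ρ_ w).hom))))
  | assoc (w w' w'' : FreeSym T) :
      LaxRel T
        (.comp (.whiskerRight (.gen (.mul w w')) _)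
          (.comp (.gen (.mul _ w'')) (.gen (.map (α_ w w' w'').hom))))
        (.comp (.assocHom _ _ _)
          (.comp (.whiskerLeft _ (.gen (.mul w' w''))) (.gen (.mul w _))))
  | braid (w w' : FreeSym T) :
      LaxRel T (.comp (.gen (.mul w w')) (.gen (.map (β_ w w').hom)))
        (.comp (.braid _ _) (.gen (.mul w' w)))

/-- The target of the free lax symmetric monoidal functor on the set `T`. -/
abbrev LaxFree (T : Type u) : Type u := Presented (LaxGen T) (LaxRel T)

/-- The free lax symmetric monoidal functor on `T`. -/
def freeLax (T : Type u) : FreeSym T ⥤ LaxFree T where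
  obj w := Word.atom w
  map f := Presented.mk (.gen (.map f))
  map_id w := Presented.sound (.rel (.map_id w))
  map_comp f g := Presented.sound (.rel (.map_comp f g))

instance (T : Type u) : (freeLax T).LaxBraided where
  ε := Presented.mk (.gen .unit)
  μ w w' := Presented.mk (.gen (.mul w w'))
  μ_natural_left f z := Presented.sound (.rel (.mul_left f z))
  μ_natural_right z f := Presented.sound (.rel (.mul_right z f))
  associativity w w' w'' := Presented.sound (.rel (.assoc w w' w''))
  left_unitality w := Presented.sound (.rel (.unit_left w))
  right_unitality w := Presented.sound (.rel (.unit_right w))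
  braided w w' := Presented.sound (.rel (.braid w w'))

variable {T : Type u} {C : Type u₁} [Category.{v₁} C] [MonoidalCategory C] [SymmetricCategory C]
  {D : Type u₂} [Category.{v₂} D] [MonoidalCategory D] [SymmetricCategory D]

open Functor.LaxMonoidal in
/-- The values of the generators in the target of a lax symmetric monoidal functor `F`. -/
def laxEvalGen (F : C ⥤ D) [F.LaxBraided] (x : T → C) : ∀ {V W : Word (FreeSym T)},
    LaxGen T V W → (Presented.evalObj (fun w => F.obj ((symEval x).obj w)) V ⟶
      Presented.evalObj (fun w => F.obj ((symEval x).obj w)) W)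
  | _, _, .map f => F.map ((symEval x).map f)
  | _, _, .unit => ε F
  | _, _, .mul _ _ => μ F _ _

/-- The strict symmetric monoidal functor from the target of the free lax symmetric monoidal
functor on `T` to the target of a lax symmetric monoidal functor `F : C ⥤ D`, determined by a map
from `T` to the objects of `C`. -/
def laxEval (F : C ⥤ D) [F.LaxBraided] (x : T → C) : LaxFree T ⥤ D :=
  Presented.lift (fun w => F.obj ((symEval x).obj w)) (laxEvalGen F x) (by
    intro V W p q h
    induction h with
    | map_id w => simp [Presented.evalPre, laxEvalGen, Presented.evalObj]
    | map_comp f g =>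
      exact (congrArg F.map ((symEval x).map_comp f g)).trans (F.map_comp _ _)
    | mul_left f z =>
      obtain ⟨f, rfl⟩ := Presented.mk_surjective f
      exact Functor.LaxMonoidal.μ_natural_left F ((symEval x).map (Presented.mk f)) _
    | mul_right z f =>
      obtain ⟨f, rfl⟩ := Presented.mk_surjective f
      exact Functor.LaxMonoidal.μ_natural_right F _ ((symEval x).map (Presented.mk f))
    | unit_left w => exact Functor.LaxMonoidal.left_unitality F _
    | unit_right w => exact Functor.LaxMonoidal.right_unitality F _
    | assoc w w' w'' => exact Functor.LaxMonoidal.associativity F _ _ _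
    | braid w w' => exact Functor.LaxBraided.braided _ _)

theorem freeLax_comp_laxEval (F : C ⥤ D) [F.LaxBraided] (x : T → C) :
    freeLax T ⋙ laxEval F x = symEval x ⋙ F := rfl

end Free


/-! ### Underlying permutations and supporting maps -/

section Positions

variable {A : Type u} {G : Word A → Word A → Type v}
  {R : ∀ ⦃V W : Word A⦄, Pre G V W → Pre G V W → Prop}

namespace Word

/-- The disjoint union, over the occurrences of atoms in a word, of sets attached to the atoms. -/
def Pts (B : A → Type) : Word A → Type
  | .atom x => B x
  | .unit => Empty
  | .tensor V W => V.Pts B ⊕ W.Pts B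

/-- A function on `V.Pts B` that is given on each atom. -/
def elim {B : A → Type} {S : Type*} (l : ∀ x, B x → S) : ∀ V : Word A, V.Pts B → S
  | .atom x => l x
  | .unit => Empty.elim
  | .tensor V W => Sum.elim (elim l V) (elim l W)

/-- The map `V.Pts B → V.Pts B'` induced by maps on the atoms. -/
def mapPts {B B' : A → Type} (h : ∀ x, B x → B' x) : ∀ V : Word A, V.Pts B → V.Pts B'
  | .atom x => h x
  | .unit => id
  | .tensor V W => Sum.map (mapPts h V) (mapPts h W)

/-- The sum, over the occurrences of atoms in a word, of numbers attached to the atoms. -/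
def count (c : A → ℕ) : Word A → ℕ
  | .atom x => c x
  | .unit => 0
  | .tensor V W => V.count c + W.count c

/-- The numbering of `V.Pts B` from left to right. -/
def enum {B : A → Type} {c : A → ℕ} (e : ∀ x, B x ≃ Fin (c x)) :
    ∀ V : Word A, V.Pts B ≃ Fin (V.count c)
  | .atom x => e x
  | .unit => Equiv.equivOfIsEmpty Empty (Fin 0)
  | .tensor V W => (Equiv.sumCongr (enum e V) (enum e W)).trans finSumFinEquiv

end Word

namespace Pre

/-- The map on points induced by a formal composite, given the maps induced by the generators.
Associators and unitors preserve the left to right order and symmetries exchange two blocks. -/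
def pts (B : A → Type) (g : ∀ {V W}, G V W → V.Pts B → W.Pts B) :
    ∀ {V W : Word A}, Pre G V W → V.Pts B → W.Pts B
  | _, _, .gen x => g x
  | _, _, .id _ => fun i => i
  | _, _, .comp f h => pts B g h ∘ pts B g f
  | _, _, .whiskerLeft _ f => Sum.map (fun i => i) (pts B g f)
  | _, _, .whiskerRight f _ => Sum.map (pts B g f) (fun i => i)
  | _, _, .assocHom _ _ _ => Equiv.sumAssoc _ _ _
  | _, _, .assocInv _ _ _ => (Equiv.sumAssoc _ _ _).symm
  | _, _, .leftHom _ => Equiv.emptySum Empty _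
  | _, _, .leftInv _ => Sum.inr
  | _, _, .rightHom _ => Equiv.sumEmpty _ Empty
  | _, _, .rightInv _ => Sum.inl
  | _, _, .braid _ _ => Sum.swap

theorem pts_congr (B : A → Type) (g : ∀ {V W}, G V W → V.Pts B → W.Pts B)
    (hR : ∀ {V W} {p q : Pre G V W}, R p q → p.pts B g = q.pts B g)
    {V W : Word A} {p q : Pre G V W} (h : PreRel G R p q) : p.pts B g = q.pts B g := by
  induction h with
  | rel h => exact hR h
  | refl => rfl
  | symm _ ih => exact ih.symm
  | trans _ _ ih ih' => exact ih.trans ih'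
  | comp _ _ ih ih' => simp only [pts, ih, ih']
  | whiskerLeft _ _ ih => exact congrArg (Sum.map fun i => i) ih
  | whiskerRight _ _ ih => exact congrArg (fun k => Sum.map k fun i => i) ih
  | pentagon => funext x; rcases x with ((x | x) | x) | x <;> rfl
  | triangle => funext x; rcases x with (x | x) | x <;> first | rfl | exact Empty.elim x
  | hexagon => funext x; rcases x with (x | x) | x <;> rfl
  | assocHom_inv => funext x; rcases x with (x | x) | x <;> rfl
  | assocInv_hom => funext x; rcases x with x | (x | x) <;> rfl
  | assoc_naturality_left => funext x; rcases x with (x | x) | x <;> rfl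
  | assoc_naturality_middle => funext x; rcases x with (x | x) | x <;> rfl
  | assoc_naturality_right => funext x; rcases x with (x | x) | x <;> rfl
  | id_comp => rfl
  | comp_id => rfl
  | assoc => rfl
  | leftInv_hom => rfl
  | rightInv_hom => rfl
  | leftHom_inv => funext x; rcases x with x | x <;> first | rfl | exact Empty.elim x
  | rightHom_inv => funext x; rcases x with x | x <;> first | rfl | exact Empty.elim x
  | left_naturality => funext x; rcases x with x | x <;> first | rfl | exact Empty.elim x
  | right_naturality => funext x; rcases x with x | x <;> first | rfl | exact Empty.elim x
  | braid_unit => funext x; rcases x with x | x <;> rfl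
  | _ => funext x; rcases x with x | x <;> rfl

theorem pts_bijective (B : A → Type) (g : ∀ {V W}, G V W → V.Pts B → W.Pts B)
    (hg : ∀ {V W} (x : G V W), Function.Bijective (g x)) {V W : Word A} (p : Pre G V W) :
    Function.Bijective (p.pts B g) := by
  induction p with
  | gen x => exact hg x
  | id => exact Function.bijective_id
  | comp _ _ ih ih' => exact ih'.comp ih
  | whiskerLeft _ _ ih => exact Sum.map_bijective.2 ⟨Function.bijective_id, ih⟩
  | whiskerRight _ _ ih => exact Sum.map_bijective.2 ⟨ih, Function.bijective_id⟩
  | assocHom => exact Equiv.bijective _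
  | assocInv => exact Equiv.bijective _
  | leftHom => exact Equiv.bijective _
  | leftInv => exact (Equiv.emptySum Empty _).symm.bijective
  | rightHom => exact Equiv.bijective _
  | rightInv => exact (Equiv.sumEmpty _ Empty).symm.bijective
  | braid => exact (Equiv.sumComm _ _).bijective

theorem elim_pts {B : A → Type} {S : Type*} (l : ∀ x, B x → S)
    (g : ∀ {V W}, G V W → V.Pts B → W.Pts B)
    (hg : ∀ {V W} (x : G V W) (i), W.elim l (g x i) = V.elim l i) {V W : Word A}
    (p : Pre G V W) (i : V.Pts B) : W.elim l (p.pts B g i) = V.elim l i := by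
  induction p with
  | gen x => exact hg x i
  | id => rfl
  | comp _ _ ih ih' => exact (ih' _).trans (ih _)
  | whiskerLeft _ _ ih => rcases i with i | i; exacts [rfl, ih i]
  | whiskerRight _ _ ih => rcases i with i | i; exacts [ih i, rfl]
  | assocHom => rcases i with (i | i) | i <;> rfl
  | assocInv => rcases i with i | (i | i) <;> rfl
  | leftHom => rcases i with i | i; exacts [Empty.elim i, rfl]
  | leftInv => rfl
  | rightHom => rcases i with i | i; exacts [rfl, Empty.elim i]
  | rightInv => rfl
  | braid => rcases i with i | i <;> rfl

theorem mapPts_pts {B B' : A → Type} (h : ∀ x, B x → B' x)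
    (g : ∀ {V W}, G V W → V.Pts B → W.Pts B) (g' : ∀ {V W}, G V W → V.Pts B' → W.Pts B')
    (hg : ∀ {V W} (x : G V W) (i), W.mapPts h (g x i) = g' x (V.mapPts h i)) {V W : Word A}
    (p : Pre G V W) (i : V.Pts B) :
    W.mapPts h (p.pts B g i) = p.pts B' g' (V.mapPts h i) := by
  induction p with
  | gen x => exact hg x i
  | id => rfl
  | comp f k ih ih' => exact (ih' _).trans (congrArg (k.pts B' g') (ih _))
  | whiskerLeft _ _ ih => rcases i with i | i; exacts [rfl, congrArg Sum.inr (ih i)]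
  | whiskerRight _ _ ih => rcases i with i | i; exacts [congrArg Sum.inl (ih i), rfl]
  | assocHom => rcases i with (i | i) | i <;> rfl
  | assocInv => rcases i with i | (i | i) <;> rfl
  | leftHom => rcases i with i | i; exacts [Empty.elim i, rfl]
  | leftInv => rfl
  | rightHom => rcases i with i | i; exacts [rfl, Empty.elim i]
  | rightInv => rfl
  | braid => rcases i with i | i <;> rfl

end Pre

/-- The map on points induced by a morphism of a presented symmetric monoidal category. -/
def Presented.pts (B : A → Type) (g : ∀ {V W}, G V W → V.Pts B → W.Pts B)
    (hR : ∀ {V W} {p q : Pre G V W}, R p q → p.pts B g = q.pts B g)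
    {V W : Presented G R} (f : V ⟶ W) : Word.Pts B V → Word.Pts B W :=
  Quotient.lift (fun p : Pre G V W => p.pts B g) (fun _ _ h => Pre.pts_congr B g hR h) f

end Positions

section Invariants

variable {T : Type u}

/-- The occurrences of letters in a word of the free symmetric monoidal category. -/
def SymLetter (w : FreeSym T) : Type := Word.Pts (fun _ => Unit) w

/-- The bijection on occurrences of letters induced by a morphism of the free symmetric monoidal
category. -/
def symPerm {w w' : FreeSym T} (f : w ⟶ w') : SymLetter w → SymLetter w' :=
  Presented.pts (fun _ => Unit) (fun e => e.elim) (fun h => h.elim) f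

theorem symPerm_bijective {w w' : FreeSym T} (f : w ⟶ w') : Function.Bijective (symPerm f) := by
  obtain ⟨f, rfl⟩ := Presented.mk_surjective f
  exact Pre.pts_bijective _ _ (fun e => e.elim) f

theorem symPerm_comp {w w' w'' : FreeSym T} (f : w ⟶ w') (g : w' ⟶ w'') :
    symPerm (f ≫ g) = symPerm g ∘ symPerm f := by
  obtain ⟨f, rfl⟩ := Presented.mk_surjective f
  obtain ⟨g, rfl⟩ := Presented.mk_surjective g
  rfl

/-- The element of `T` at an occurrence of a letter. -/
def symLabel (w : FreeSym T) : SymLetter w → T := Word.elim (fun t _ => t) w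

theorem symLabel_symPerm {w w' : FreeSym T} (f : w ⟶ w') (i : SymLetter w) :
    symLabel w' (symPerm f i) = symLabel w i := by
  obtain ⟨f, rfl⟩ := Presented.mk_surjective f
  exact Pre.elim_pts _ _ (fun e => e.elim) f i

/-- The numbering of the letters of a word from left to right. -/
def symEnum (w : FreeSym T) : SymLetter w ≃ Fin (Word.count (fun _ => 1) w) :=
  Word.enum (fun _ => (Equiv.ofUnique Unit (Fin 1))) w

/-- The occurrences of letters of `T` in an object of `LaxFree T`. -/
def Letter (V : LaxFree T) : Type := Word.Pts SymLetter V

/-- The number of occurrences of letters of `T` in an object of `LaxFree T`. -/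
def numLetters (V : LaxFree T) : ℕ := Word.count (Word.count fun _ => 1) V

/-- The numbering of the letters from left to right. -/
def letterEnum (V : LaxFree T) : Letter V ≃ Fin (numLetters V) := Word.enum symEnum V

/-- The element of `T` at an occurrence of a letter. -/
def label (V : LaxFree T) : Letter V → T := Word.elim symLabel V

/-- The blocks of an object of `LaxFree T`: the occurrences of expressions `F(w)`. -/
def Block (V : LaxFree T) : Type := Word.Pts (fun _ => Unit) V

/-- The number of expressions `F(w)` in an object of `LaxFree T`. -/
def numBlocks (V : LaxFree T) : ℕ := Word.count (fun _ => 1) V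

/-- The numbering of the blocks from left to right. -/
def blockEnum (V : LaxFree T) : Block V ≃ Fin (numBlocks V) :=
  Word.enum (fun _ => (Equiv.ofUnique Unit (Fin 1))) V

/-- The block in which a letter lies. -/
def blockOf (V : LaxFree T) : Letter V → Block V := Word.mapPts (fun _ _ => ()) V

/-- Permutations of letters induced by the generators: `F(f)` acts through the underlying
permutation of `f`, and the unit and composition maps do not permute the letters. -/
def genPerm : ∀ {V W : Word (FreeSym T)}, LaxGen T V W → V.Pts SymLetter → W.Pts SymLetter
  | _, _, .map f => symPerm f
  | _, _, .unit => id
  | _, _, .mul _ _ => id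

/-- Maps of blocks induced by the generators: the identity for `F(f)`, the inclusion of the empty
set for the unit map, and the fold map for the composition map. -/
def genSupp : ∀ {V W : Word (FreeSym T)}, LaxGen T V W →
    V.Pts (fun _ => Unit) → W.Pts (fun _ => Unit)
  | _, _, .map _ => id
  | _, _, .unit => Empty.elim
  | _, _, .mul _ _ => fun _ => ()

/-- The map on occurrences of letters induced by a morphism of `LaxFree T`. -/
def letterMap {V W : LaxFree T} (f : V ⟶ W) : Letter V → Letter W :=
  Presented.pts SymLetter genPerm (by
    intro V W p q h
    induction h with
    | map_id w => rfl
    | map_comp f g => exact symPerm_comp f g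
    | mul_left f z =>
      obtain ⟨f, rfl⟩ := Presented.mk_surjective f
      rfl
    | mul_right z f =>
      obtain ⟨f, rfl⟩ := Presented.mk_surjective f
      rfl
    | unit_left w => funext x; rcases x with x | x; exacts [Empty.elim x, rfl]
    | unit_right w => funext x; rcases x with x | x; exacts [rfl, Empty.elim x]
    | assoc w w' w'' => funext x; rcases x with (x | x) | x <;> rfl
    | braid w w' => funext x; rcases x with x | x <;> rfl) f

theorem letterMap_bijective {V W : LaxFree T} (f : V ⟶ W) : Function.Bijective (letterMap f) := by
  obtain ⟨f, rfl⟩ := Presented.mk_surjective f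
  refine Pre.pts_bijective _ _ (fun x => ?_) f
  cases x with
  | map f => exact symPerm_bijective f
  | unit => exact Function.bijective_id
  | mul => exact Function.bijective_id

theorem label_letterMap {V W : LaxFree T} (f : V ⟶ W) (i : Letter V) :
    label W (letterMap f i) = label V i := by
  obtain ⟨f, rfl⟩ := Presented.mk_surjective f
  refine Pre.elim_pts _ _ (fun x i => ?_) f i
  cases x with
  | map f => exact symLabel_symPerm f i
  | unit => exact Empty.elim i
  | mul => rfl

/-- The underlying permutation of a morphism of `LaxFree T`, as a bijection from the positions of
the letters of the source to the positions of the letters of the target. -/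
noncomputable def underlyingPerm {V W : LaxFree T} (f : V ⟶ W) :
    Fin (numLetters V) ≃ Fin (numLetters W) :=
  ((letterEnum V).symm.trans (Equiv.ofBijective _ (letterMap_bijective f))).trans (letterEnum W)

/-- The map of blocks induced by a morphism of `LaxFree T`. -/
def blockMap {V W : LaxFree T} (f : V ⟶ W) : Block V → Block W :=
  Presented.pts (fun _ => Unit) genSupp (by
    intro V W p q h
    induction h with
    | unit_left w => funext x; rcases x with x | x; exacts [Empty.elim x, rfl]
    | unit_right w => funext x; rcases x with x | x; exacts [rfl, Empty.elim x]
    | _ => rfl) f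

theorem blockOf_letterMap {V W : LaxFree T} (f : V ⟶ W) (i : Letter V) :
    blockOf W (letterMap f i) = blockMap f (blockOf V i) := by
  obtain ⟨f, rfl⟩ := Presented.mk_surjective f
  refine Pre.mapPts_pts _ _ _ (fun x i => ?_) f i
  cases x with
  | map f => rfl
  | unit => exact Empty.elim i
  | mul => rfl

/-- The category with objects `{1, …, n}` for `n ≥ 0` and all maps of finite sets. -/
abbrev FinCat : Type := FintypeCat.Skeleton.{0}

/-- The supporting map of a morphism of `LaxFree T`, as a map from the (numbered) blocks of the
source to the blocks of the target. -/
def supportMap : LaxFree T ⥤ FinCat where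
  obj V := FintypeCat.Skeleton.mk (numBlocks V)
  map {V W} f := fun j => ⟨blockEnum W (blockMap f ((blockEnum V).symm j.down))⟩
  map_id V := by
    funext j
    exact congrArg ULift.up ((blockEnum V).apply_symm_apply j.down)
  map_comp {V W Z} f g := by
    funext j
    obtain ⟨f, rfl⟩ := Presented.mk_surjective f
    obtain ⟨g, rfl⟩ := Presented.mk_surjective g
    refine congrArg ULift.up (congrArg (blockEnum Z) (congrArg (blockMap (Presented.mk g)) ?_))
    exact ((blockEnum W).symm_apply_apply _).symm

end Invariants

/-! ### Formal diagrams -/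

section Diagrams

variable {J : Type w₁} [Quiver.{w₂} J]

/-- A diagram commutes if any two parallel composites in it are equal. -/
def Commutes {D : Type u₂} [Category.{v₂} D] (d : J ⥤q D) : Prop :=
  ∀ ⦃a b : J⦄ (p q : Quiver.Path a b), composePath (d.mapPath p) = composePath (d.mapPath q)

variable {C : Type u₁} [Category.{v₁} C] [MonoidalCategory C] [SymmetricCategory C]
  {D : Type u₂} [Category.{v₂} D] [MonoidalCategory D] [SymmetricCategory D]

/-- Two parallel formal morphisms have the same supporting maps and underlying permutations. -/
def SameShape {T : Type u} {V W : LaxFree T} (f g : V ⟶ W) : Prop :=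
  supportMap.map f = supportMap.map g ∧ underlyingPerm f = underlyingPerm g

/-- A diagram in the target of a lax symmetric monoidal functor `F : C ⥤ D` is a formal diagram
that is expected to commute: it has a lift along `LaxFree C ⥤ D` in which parallel composites have
the same supporting maps and underlying permutations. -/
def LaxExpectedToCommute (F : C ⥤ D) [F.LaxBraided] (d : J ⥤q D) : Prop :=
  ∃ l : J ⥤q LaxFree C, l ⋙q (laxEval F (fun c : C => c)).toPrefunctor = d ∧
    ∀ ⦃a b : J⦄ (p q : Quiver.Path a b),
      SameShape (composePath (l.mapPath p)) (composePath (l.mapPath q))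

/-- An oplax symmetric monoidal functor: an oplax monoidal functor compatible with the
symmetries. The maps `η : F(I) ⟶ I` and `δ : F(X ⊗ Y) ⟶ F(X) ⊗ F(Y)` are those of Mathlib. -/
class OplaxSymmetric (F : C ⥤ D) extends F.OplaxMonoidal where
  braided : ∀ X Y : C, F.map (β_ X Y).hom ≫ δ Y X = δ X Y ≫ (β_ (F.obj X) (F.obj Y)).hom

/-- The opposite of a symmetric monoidal category is symmetric monoidal. -/
abbrev symmetricOp (C : Type u₁) [Category.{v₁} C] [MonoidalCategory C] [SymmetricCategory C] :
    SymmetricCategory Cᵒᵖ where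
  symmetry _ _ := Quiver.Hom.unop_inj (SymmetricCategory.symmetry _ _)

attribute [local instance] symmetricOp

open Functor.OplaxMonoidal in
/-- The opposite of an oplax symmetric monoidal functor is lax symmetric monoidal. -/
abbrev laxOp (F : C ⥤ D) [OplaxSymmetric F] : F.op.LaxBraided where
  ε := (η F).op
  μ X Y := (δ F X.unop Y.unop).op
  μ_natural_left f X := Quiver.Hom.unop_inj (δ_natural_left F f.unop X.unop)
  μ_natural_right X f := Quiver.Hom.unop_inj (δ_natural_right F X.unop f.unop)
  associativity X Y Z := Quiver.Hom.unop_inj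
    ((Category.assoc _ _ _).trans
      ((associativity_inv F X.unop Y.unop Z.unop).symm.trans (Category.assoc _ _ _).symm))
  left_unitality X := Quiver.Hom.unop_inj
    ((oplax_left_unitality F X.unop).trans (Category.assoc _ _ _).symm)
  right_unitality X := Quiver.Hom.unop_inj
    ((oplax_right_unitality F X.unop).trans (Category.assoc _ _ _).symm)
  braided X Y := Quiver.Hom.unop_inj (OplaxSymmetric.braided Y.unop X.unop)

/-- For an oplax functor the unit and composition maps point the other way, so that formal
morphisms live in the opposite of `LaxFree C`. A formal morphism is evaluated by evaluating the
opposite morphism at the lax symmetric monoidal functor `Cᵒᵖ ⥤ Dᵒᵖ`. -/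
def oplaxEval (F : C ⥤ D) [OplaxSymmetric F] : (LaxFree C)ᵒᵖ ⥤ D :=
  letI := laxOp F
  (laxEval F.op (fun c : C => Opposite.op c)).leftOp

/-- A diagram in the target of an oplax symmetric monoidal functor is a formal diagram that is
expected to commute. -/
def OplaxExpectedToCommute (F : C ⥤ D) [OplaxSymmetric F] (d : J ⥤q D) : Prop :=
  ∃ l : J ⥤q (LaxFree C)ᵒᵖ, l ⋙q (oplaxEval F).toPrefunctor = d ∧
    ∀ ⦃a b : J⦄ (p q : Quiver.Path a b),
      SameShape (composePath (l.mapPath p)).unop (composePath (l.mapPath q)).unop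

end Diagrams

/-! ### The supporting set functor on a component with distinct letters -/

section Support

variable {T : Type u} {n : ℕ}

/-- Each of `X 0, …, X (n - 1)` occurs exactly once in `W`, and no other letter does. -/
def HasLetters (X : Fin n → T) (W : LaxFree T) : Prop :=
  ∃ e : Fin n ≃ Letter W, ∀ i, label W (e i) = X i

theorem HasLetters.iff_of_hom {X : Fin n → T} {V W : LaxFree T} (f : V ⟶ W) :
    HasLetters X V ↔ HasLetters X W := by
  constructor
  · rintro ⟨e, he⟩
    exact ⟨e.trans (Equiv.ofBijective _ (letterMap_bijective f)),
      fun i => (label_letterMap f _).trans (he i)⟩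
  · rintro ⟨e, he⟩
    refine ⟨e.trans (Equiv.ofBijective _ (letterMap_bijective f)).symm, fun i => ?_⟩
    rw [← label_letterMap f, ← he i]
    exact congrArg (label W) ((Equiv.ofBijective _ (letterMap_bijective f)).apply_symm_apply _)

theorem HasLetters.of_zigzag {X : Fin n → T} {V W : LaxFree T} (h : Zigzag V W)
    (hV : HasLetters X V) : HasLetters X W := by
  induction h with
  | refl => exact hV
  | tail _ h ih =>
    rcases h with ⟨⟨f⟩⟩ | ⟨⟨f⟩⟩
    · exact (HasLetters.iff_of_hom f).1 ih
    · exact (HasLetters.iff_of_hom f).2 ih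

/-- The connected component of an object. -/
abbrev ComponentOf (W : LaxFree T) : Type u := (CategoryTheory.ConnectedComponents.mk W).Component

theorem HasLetters.of_comp {X : Fin n → T} {W : LaxFree T} (hW : HasLetters X W) (V : ComponentOf W) :
    HasLetters X V.obj :=
  HasLetters.of_zigzag (Quotient.exact' V.property).symm hW

/-- The place in `V` where the letter `X i` occurs. -/
noncomputable def place {X : Fin n → T} {V : LaxFree T} (hV : HasLetters X V) :
    Fin n ≃ Letter V :=
  hV.choose

theorem label_place {X : Fin n → T} {V : LaxFree T} (hV : HasLetters X V) (i : Fin n) :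
    label V (place hV i) = X i :=
  hV.choose_spec i

theorem letterMap_place {X : Fin n → T} (hX : Function.Injective X) {V W : LaxFree T}
    (hV : HasLetters X V) (hW : HasLetters X W) (f : V ⟶ W) (i : Fin n) :
    letterMap f (place hV i) = place hW i := by
  obtain ⟨j, hj⟩ := (place hW).surjective (letterMap f (place hV i))
  rw [← hj]
  congr 1
  apply hX
  rw [← label_place hW, hj, label_letterMap, label_place]

/-- The supporting set functor to `(n ↓ Fin)`, on the component of a word in distinct letters
`X 0, …, X (n - 1)`. A word with `k` blocks goes to the map `n → k` taking `i` to the block in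
which `X i` lies. -/
noncomputable def supportingSet (X : Fin n → T) (hX : Function.Injective X) (W : LaxFree T)
    (hW : HasLetters X W) : ComponentOf W ⥤ Under (FintypeCat.Skeleton.mk n : FinCat) where
  obj V := Under.mk (Y := supportMap.obj V.obj)
    (fun i => ⟨blockEnum V.obj (blockOf V.obj (place (hW.of_comp V) i.down))⟩)
  map {V V'} f := Under.homMk (supportMap.map f.hom) (by
    funext i
    refine congrArg ULift.up (congrArg (blockEnum V'.obj) ?_)
    have h₁ := congrArg (blockMap f.hom) ((blockEnum V.obj).symm_apply_apply
      (blockOf V.obj (place (hW.of_comp V) i.down)))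
    have h₂ := congrArg (blockOf V'.obj)
      (letterMap_place hX (hW.of_comp V) (hW.of_comp V') f.hom i.down)
    exact h₁.trans ((blockOf_letterMap f.hom _).symm.trans h₂))
  map_id V := by
    ext : 1
    exact supportMap.map_id V.obj
  map_comp f g := by
    ext : 1
    exact supportMap.map_comp f.hom g.hom

end Support

end SymCoherence

namespace SymCoherence

/-! ### Morphisms compatible with binary tensor decompositions -/

section Decomposition

variable {D : Type u₂} [Category.{v₂} D] [MonoidalCategory D]

/-! A morphism of `LaxFree T` is determined by its maps on letters and on blocks
(`eq_of_letterMap_blockMap`); this faithfulness gives both diagram statements at once. It is proved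
by induction on the target word, through a criterion `Presented.eq_of_rel` that also covers `FreeSym
T`.

The inductive step rests on splitting. Colour the atoms of the target of `f` with two colours and
pull the colouring back along the map of atoms induced by `f`. Up to a canonical isomorphism
`split`, source and target are tensor products of their monochromatic parts, and `f` becomes a
tensor product of two morphisms (`Presented.splits_mk`). This holds for the structure maps because
the tensor product is itself a symmetric monoidal functor `D × D ⥤ D`, with `tensorμ` as structure
map, and for the generators because each has a single atom as target, so it lies entirely in one
colour. For a target `W₁ ⊗ W₂`, colour the two factors differently: parallel morphisms with the same
block map split along the same decompositions, and the pieces have targets isomorphic to `W₁` and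
`W₂`.

The base cases are the unit and a single atom. A word mapping to the unit has no atoms, and between
words without atoms only structure maps occur; these commute with the canonical map `blank` to the
unit. For `FreeSym T`, a word mapping to a letter consists of that letter and units, and `single`
plays the role of `blank`. For `LaxFree T`, merging all blocks is natural (`merge_naturality`), so
every `V ⟶ F(w)` is the merge of `V` followed by `F(k)`, where `k` is determined by its permutation
by the symmetric case.

For the supporting set functor, distinct letters force the letter map, so faithfulness is the same
theorem. Fullness (`exists_blockMap_eq`) repeats the induction, splitting the source along the
prescribed block map. Essential surjectivity tensors one `F(w_j)` per block, with `w_j` a word in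
the fibre over `j`. The component of `W` consists of all words in the same letters, since two such
words are joined through their merges. -/

/-- The decomposition of the unit. -/
def unitDecomp : 𝟙_ D ≅ 𝟙_ D ⊗ 𝟙_ D := (λ_ (𝟙_ D)).symm

/-- The morphism `f` is a tensor product with respect to given decompositions. -/
def Splits {V V₁ V₂ W W₁ W₂ : D} (d : V ≅ V₁ ⊗ V₂) (e : W ≅ W₁ ⊗ W₂) (f : V ⟶ W) : Prop :=
  ∃ (f₁ : V₁ ⟶ W₁) (f₂ : V₂ ⟶ W₂), f ≫ e.hom = d.hom ≫ (f₁ ⊗ₘ f₂)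

namespace Splits

variable {V V₁ V₂ W W₁ W₂ Z Z₁ Z₂ : D} {a : V ≅ V₁ ⊗ V₂} {b : W ≅ W₁ ⊗ W₂} {c : Z ≅ Z₁ ⊗ Z₂}

theorem comp {f : V ⟶ W} {g : W ⟶ Z} (hf : Splits a b f) (hg : Splits b c g) :
    Splits a c (f ≫ g) := by
  obtain ⟨f₁, f₂, hf⟩ := hf
  obtain ⟨g₁, g₂, hg⟩ := hg
  refine ⟨f₁ ≫ g₁, f₂ ≫ g₂, ?_⟩
  rw [Category.assoc, hg, reassoc_of% hf, tensorHom_comp_tensorHom]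

theorem id (a : V ≅ V₁ ⊗ V₂) : Splits a a (𝟙 V) := ⟨𝟙 _, 𝟙 _, by simp⟩

/-- The factors are taken to be isomorphisms because it is their inverses that split the inverse. -/
theorem inv_of_iso {f : V ≅ W} (f₁ : V₁ ≅ W₁) (f₂ : V₂ ≅ W₂)
    (h : f.hom ≫ b.hom = a.hom ≫ (f₁.hom ⊗ₘ f₂.hom)) : Splits b a f.inv := by
  refine ⟨f₁.inv, f₂.inv, ?_⟩
  rw [Iso.inv_comp_eq, reassoc_of% h, tensorHom_comp_tensorHom]
  simp

end Splits

variable [SymmetricCategory D]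

/-- The interchange of the inner factors is compatible with the symmetries. -/
theorem tensorμ_braiding (X₁ X₂ Y₁ Y₂ : D) :
    (β_ (X₁ ⊗ X₂) (Y₁ ⊗ Y₂)).hom ≫ tensorμ Y₁ Y₂ X₁ X₂ =
      tensorμ X₁ X₂ Y₁ Y₂ ≫ ((β_ X₁ Y₁).hom ⊗ₘ (β_ X₂ Y₂).hom) := by
  -- The left side crosses `X₁` with `Y₂` and then back; the two crossings cancel because the
  -- braiding is a symmetry.
  simp [tensorμ, SymmetricCategory.braiding_swap_eq_inv_braiding X₁ Y₂,
    MonoidalCategory.tensorHom_def]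

/-- The tensor product of two decompositions. -/
def tensorDecomp {V V₁ V₂ W W₁ W₂ : D} (d : V ≅ V₁ ⊗ V₂) (e : W ≅ W₁ ⊗ W₂) :
    V ⊗ W ≅ (V₁ ⊗ W₁) ⊗ (V₂ ⊗ W₂) :=
  (d ⊗ᵢ e) ≪≫ ⟨tensorμ _ _ _ _, tensorδ _ _ _ _, by simp, by simp⟩

namespace Splits

variable {V V₁ V₂ W W₁ W₂ Z Z₁ Z₂ : D} {a : V ≅ V₁ ⊗ V₂} {b : W ≅ W₁ ⊗ W₂} {c : Z ≅ Z₁ ⊗ Z₂}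

theorem whiskerLeft (a : V ≅ V₁ ⊗ V₂) {f : W ⟶ Z} (hf : Splits b c f) :
    Splits (tensorDecomp a b) (tensorDecomp a c) (V ◁ f) := by
  obtain ⟨f₁, f₂, hf⟩ := hf
  refine ⟨V₁ ◁ f₁, V₂ ◁ f₂, ?_⟩
  simp only [tensorDecomp, Iso.trans_hom, tensorIso_hom, Category.assoc]
  rw [← tensorμ_natural_right]
  simp only [← id_tensorHom, tensorHom_comp_tensorHom_assoc, Category.id_comp, Category.comp_id, hf]

theorem whiskerRight {f : V ⟶ W} (hf : Splits a b f) (c : Z ≅ Z₁ ⊗ Z₂) :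
    Splits (tensorDecomp a c) (tensorDecomp b c) (f ▷ Z) := by
  obtain ⟨f₁, f₂, hf⟩ := hf
  refine ⟨f₁ ▷ Z₁, f₂ ▷ Z₂, ?_⟩
  simp only [tensorDecomp, Iso.trans_hom, tensorIso_hom, Category.assoc]
  rw [← tensorμ_natural_left]
  simp only [← tensorHom_id, tensorHom_comp_tensorHom_assoc, Category.id_comp, Category.comp_id, hf]

/-- This is the associativity axiom of the monoidal functor `⊗ : D × D ⥤ D`, transported along the
decompositions; the unitor lemmas below are its unit axioms. -/
theorem associator_aux (a : V ≅ V₁ ⊗ V₂) (b : W ≅ W₁ ⊗ W₂) (c : Z ≅ Z₁ ⊗ Z₂) :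
    (α_ V W Z).hom ≫ (tensorDecomp a (tensorDecomp b c)).hom =
      (tensorDecomp (tensorDecomp a b) c).hom ≫
        ((α_ V₁ W₁ Z₁).hom ⊗ₘ (α_ V₂ W₂ Z₂).hom) := by
  simp only [tensorDecomp, Iso.trans_hom, tensorIso_hom, Category.assoc]
  have h := tensor_associativity V₁ V₂ W₁ W₂ Z₁ Z₂
  calc _ = ((a.hom ⊗ₘ b.hom) ⊗ₘ c.hom) ≫ (α_ _ _ _).hom ≫
        ((V₁ ⊗ V₂) ◁ tensorμ W₁ W₂ Z₁ Z₂) ≫ tensorμ V₁ V₂ (W₁ ⊗ Z₁) (W₂ ⊗ Z₂) := by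
        rw [associator_naturality_assoc, ← id_tensorHom, tensorHom_comp_tensorHom_assoc,
          Category.comp_id]
    _ = _ := by
        rw [← h, ← tensorHom_id, tensorHom_comp_tensorHom_assoc, Category.comp_id]

theorem associator_hom (a : V ≅ V₁ ⊗ V₂) (b : W ≅ W₁ ⊗ W₂) (c : Z ≅ Z₁ ⊗ Z₂) :
    Splits (tensorDecomp (tensorDecomp a b) c) (tensorDecomp a (tensorDecomp b c))
      (α_ V W Z).hom :=
  ⟨_, _, associator_aux a b c⟩

theorem associator_inv (a : V ≅ V₁ ⊗ V₂) (b : W ≅ W₁ ⊗ W₂) (c : Z ≅ Z₁ ⊗ Z₂) :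
    Splits (tensorDecomp a (tensorDecomp b c)) (tensorDecomp (tensorDecomp a b) c)
      (α_ V W Z).inv :=
  inv_of_iso _ _ (associator_aux a b c)

theorem leftUnitor_aux (a : V ≅ V₁ ⊗ V₂) :
    (λ_ V).hom ≫ a.hom = (tensorDecomp unitDecomp a).hom ≫ ((λ_ V₁).hom ⊗ₘ (λ_ V₂).hom) := by
  have h := tensor_left_unitality V₁ V₂
  simp only [tensorDecomp, unitDecomp, Iso.trans_hom, Iso.symm_hom, tensorIso_hom, Category.assoc]
  rw [← leftUnitor_naturality, h, ← id_tensorHom, ← tensorHom_id, tensorHom_comp_tensorHom_assoc,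
    Category.id_comp, Category.comp_id]

theorem rightUnitor_aux (a : V ≅ V₁ ⊗ V₂) :
    (ρ_ V).hom ≫ a.hom = (tensorDecomp a unitDecomp).hom ≫ ((ρ_ V₁).hom ⊗ₘ (ρ_ V₂).hom) := by
  have h := tensor_right_unitality V₁ V₂
  simp only [tensorDecomp, unitDecomp, Iso.trans_hom, Iso.symm_hom, tensorIso_hom, Category.assoc]
  rw [← rightUnitor_naturality, h, ← id_tensorHom, ← tensorHom_id, tensorHom_comp_tensorHom_assoc,
    Category.id_comp, Category.comp_id]

theorem leftUnitor_hom (a : V ≅ V₁ ⊗ V₂) : Splits (tensorDecomp unitDecomp a) a (λ_ V).hom :=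
  ⟨_, _, leftUnitor_aux a⟩

theorem leftUnitor_inv (a : V ≅ V₁ ⊗ V₂) : Splits a (tensorDecomp unitDecomp a) (λ_ V).inv :=
  inv_of_iso _ _ (leftUnitor_aux a)

theorem rightUnitor_hom (a : V ≅ V₁ ⊗ V₂) : Splits (tensorDecomp a unitDecomp) a (ρ_ V).hom :=
  ⟨_, _, rightUnitor_aux a⟩

theorem rightUnitor_inv (a : V ≅ V₁ ⊗ V₂) : Splits a (tensorDecomp a unitDecomp) (ρ_ V).inv :=
  inv_of_iso _ _ (rightUnitor_aux a)

theorem braiding (a : V ≅ V₁ ⊗ V₂) (b : W ≅ W₁ ⊗ W₂) :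
    Splits (tensorDecomp a b) (tensorDecomp b a) (β_ V W).hom := by
  refine ⟨(β_ V₁ W₁).hom, (β_ V₂ W₂).hom, ?_⟩
  simp only [tensorDecomp, Iso.trans_hom, tensorIso_hom, Category.assoc]
  rw [← tensorμ_braiding, BraidedCategory.braiding_naturality_assoc]

end Splits

end Decomposition

/-! ### Splitting words along a two-colouring of their atoms -/

section Splitting

variable {A : Type u} {G : Word A → Word A → Type v}
  {R : ∀ ⦃V W : Word A⦄, Pre G V W → Pre G V W → Prop}

/-- The occurrences of atoms in a word. -/
abbrev Word.Occ (V : Word A) : Type := V.Pts (fun _ => Unit)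

/-- The atom `x` if the two colours agree, and the unit otherwise. -/
def Word.keep (x : A) : Bool → Bool → Word A
  | true, true => .atom x
  | true, false => .unit
  | false, true => .unit
  | false, false => .atom x

/-- The word obtained by replacing all atoms whose colour is not `b` by units. -/
def Word.restr : ∀ V : Word A, (V.Occ → Bool) → Bool → Word A
  | .atom x, s, b => .keep x (s ()) b
  | .unit, _, _ => .unit
  | .tensor V W, s, b => .tensor (V.restr (fun i => s (.inl i)) b) (W.restr (fun i => s (.inr i)) b)

namespace Presented

/-- The decomposition of an atom according to its colour. -/
def splitAtom (x : A) : ∀ c : Bool, (of (.atom x) : Presented G R) ≅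
    of (.keep x c true) ⊗ of (.keep x c false)
  | true => (ρ_ (of (.atom x))).symm
  | false => (λ_ (of (.atom x))).symm

/-- A word is isomorphic to the tensor product of its parts of the two colours. -/
def split : ∀ (V : Word A) (s : V.Occ → Bool), (of V : Presented G R) ≅
    of (V.restr s true) ⊗ of (V.restr s false)
  | .atom x, s => splitAtom x (s ())
  | .unit, _ => unitDecomp
  | .tensor V W, s => tensorDecomp (split V (fun i => s (.inl i))) (split W (fun i => s (.inr i)))

/-- A formal composite of generators that split along every colouring of the target splits. -/
theorem splits_mk (g : ∀ {V W}, G V W → V.Occ → W.Occ)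
    (hg : ∀ {V W : Word A} (x : G V W) (s : W.Occ → Bool),
      Splits (split V (fun i => s (g x i))) (split W s) (mk (.gen x) : (of V : Presented G R) ⟶ of W))
    {V W : Word A} (p : Pre G V W) (s : W.Occ → Bool) :
    Splits (split V (fun i => s (p.pts (fun _ => Unit) g i))) (split W s)
      (mk p : (of V : Presented G R) ⟶ of W) := by
  induction p with
  | gen x => exact hg x s
  | id V => exact Splits.id _
  | comp f h ihf ihh => exact (ihf _).comp (ihh s)
  | whiskerLeft V f ih =>
    exact Splits.whiskerLeft (split V fun i => s (.inl i)) (ih fun i => s (.inr i))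
  | whiskerRight f Z ih =>
    exact Splits.whiskerRight (ih fun i => s (.inl i)) (split Z fun i => s (.inr i))
  | assocHom V W Z => exact Splits.associator_hom (split V _) (split W _) (split Z _)
  | assocInv V W Z => exact Splits.associator_inv (split V _) (split W _) (split Z _)
  | leftHom V => exact Splits.leftUnitor_hom (split V s)
  | leftInv V => exact Splits.leftUnitor_inv (split V _)
  | rightHom V => exact Splits.rightUnitor_hom (split V s)
  | rightInv V => exact Splits.rightUnitor_inv (split V _)
  | braid V W => exact Splits.braiding (split V _) (split W _)

/-- Together with `isEmpty_restr`: if the two factors of a tensor product are coloured differently,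
each monochromatic part is one factor tensored with a word without atoms. -/
theorem restr_const : ∀ (V : Word A) (s : V.Occ → Bool) (b : Bool), (∀ i, s i = b) →
    V.restr s b = V
  | .atom x, s, b, h => by
    have := h ()
    change Word.keep x (s ()) b = _
    rw [this]; cases b <;> rfl
  | .unit, _, _, _ => rfl
  | .tensor V W, s, b, h =>
    congrArg₂ Word.tensor (restr_const V _ b fun i => h (.inl i))
      (restr_const W _ b fun i => h (.inr i))

theorem isEmpty_restr : ∀ (V : Word A) (s : V.Occ → Bool) (b : Bool), (∀ i, s i ≠ b) →
    IsEmpty (V.restr s b).Occ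
  | .atom x, s, b, h => by
    have := h ()
    change IsEmpty (Word.keep x (s ()) b).Occ
    generalize s () = c at *
    cases b <;> cases c <;> first | exact (this rfl).elim | exact inferInstanceAs (IsEmpty Empty)
  | .unit, _, _, _ => inferInstanceAs (IsEmpty Empty)
  | .tensor V W, s, b, h =>
    have := isEmpty_restr V _ b fun i => h (.inl i)
    have := isEmpty_restr W _ b fun i => h (.inr i)
    inferInstanceAs (IsEmpty (_ ⊕ _))

end Presented

end Splitting

/-! ### Words with at most one atom -/

section UnitFactors

variable {D : Type u₂} [Category.{v₂} D] [MonoidalCategory D]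

/-- Collapsing the left factor of a tensor product to the unit. -/
def collapseLeft {V W N : D} (a : V ⟶ 𝟙_ D) (c : W ⟶ N) : V ⊗ W ⟶ N := (a ⊗ₘ c) ≫ (λ_ N).hom

/-- Collapsing the right factor of a tensor product to the unit. -/
def collapseRight {V W N : D} (c : V ⟶ N) (a : W ⟶ 𝟙_ D) : V ⊗ W ⟶ N := (c ⊗ₘ a) ≫ (ρ_ N).hom

variable {V W Z V' W' N : D}

/-- The two unitors of the unit agree. Right unitors and symmetries turn a left collapse into a
right one, whereas `blank` is built from left collapses only. -/
theorem collapseLeft_eq_collapseRight (a : V ⟶ 𝟙_ D) (b : W ⟶ 𝟙_ D) :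
    collapseLeft a b = collapseRight a b := by
  rw [collapseLeft, collapseRight, unitors_equal]

theorem whiskerLeft_collapseLeft (a : V ⟶ 𝟙_ D) (f : W ⟶ W') (c : W' ⟶ N) :
    V ◁ f ≫ collapseLeft a c = collapseLeft a (f ≫ c) := by
  simp [collapseLeft, ← id_tensorHom]

theorem whiskerLeft_collapseRight (c : V ⟶ N) (f : W ⟶ W') (a : W' ⟶ 𝟙_ D) :
    V ◁ f ≫ collapseRight c a = collapseRight c (f ≫ a) := by
  simp [collapseRight, ← id_tensorHom]

theorem whiskerRight_collapseLeft (f : V ⟶ V') (a : V' ⟶ 𝟙_ D) (c : W ⟶ N) :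
    f ▷ W ≫ collapseLeft a c = collapseLeft (f ≫ a) c := by
  simp [collapseLeft, ← tensorHom_id]

theorem whiskerRight_collapseRight (f : V ⟶ V') (c : V' ⟶ N) (a : W ⟶ 𝟙_ D) :
    f ▷ W ≫ collapseRight c a = collapseRight (f ≫ c) a := by
  simp [collapseRight, ← tensorHom_id]

/-- There is one associator lemma for each position of the factor that is not collapsed; here it is
the last. -/
theorem associator_collapse_right (a : V ⟶ 𝟙_ D) (b : W ⟶ 𝟙_ D) (c : Z ⟶ N) :
    (α_ V W Z).hom ≫ collapseLeft a (collapseLeft b c) = collapseLeft (collapseLeft a b) c := by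
  simp [collapseLeft, MonoidalCategory.tensorHom_def]

theorem associator_collapse_middle (a : V ⟶ 𝟙_ D) (c : W ⟶ N) (b : Z ⟶ 𝟙_ D) :
    (α_ V W Z).hom ≫ collapseLeft a (collapseRight c b) = collapseRight (collapseLeft a c) b := by
  have h : (λ_ (N ⊗ 𝟙_ D)).inv ≫ (α_ (𝟙_ D) N (𝟙_ D)).inv ≫ (ρ_ (𝟙_ D ⊗ N)).hom ≫
      (λ_ N).hom = (ρ_ N).hom := by monoidal
  simp [collapseLeft, collapseRight, MonoidalCategory.tensorHom_def, h]

theorem associator_collapse_left (c : V ⟶ N) (a : W ⟶ 𝟙_ D) (b : Z ⟶ 𝟙_ D) :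
    (α_ V W Z).hom ≫ collapseRight c (collapseLeft a b) = collapseRight (collapseRight c a) b := by
  simp [collapseLeft, collapseRight, MonoidalCategory.tensorHom_def]

theorem leftUnitor_collapse (c : W ⟶ N) :
    (λ_ W).hom ≫ c = collapseLeft (𝟙 (𝟙_ D)) c := by
  simp [collapseLeft]

theorem rightUnitor_collapse (c : V ⟶ N) :
    (ρ_ V).hom ≫ c = collapseRight c (𝟙 (𝟙_ D)) := by
  simp [collapseRight]

theorem braiding_collapseLeft [SymmetricCategory D] (c : V ⟶ N) (a : W ⟶ 𝟙_ D) :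
    (β_ V W).hom ≫ collapseLeft a c = collapseRight c a := by
  rw [collapseLeft, collapseRight, ← BraidedCategory.braiding_naturality_assoc,
    braiding_leftUnitor]

theorem braiding_collapseRight [SymmetricCategory D] (a : V ⟶ 𝟙_ D) (c : W ⟶ N) :
    (β_ V W).hom ≫ collapseRight c a = collapseLeft a c := by
  rw [collapseLeft, collapseRight, ← BraidedCategory.braiding_naturality_assoc,
    braiding_rightUnitor]

end UnitFactors

/-! ### Canonical maps out of words with no atom or one atom -/

section Small

variable {A : Type u} {G : Word A → Word A → Type v}
  {R : ∀ ⦃V W : Word A⦄, Pre G V W → Pre G V W → Prop}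

theorem Word.isEmpty_left {V W : Word A} (h : IsEmpty (V.tensor W).Occ) : IsEmpty V.Occ :=
  ⟨fun i => h.false (.inl i)⟩

theorem Word.isEmpty_right {V W : Word A} (h : IsEmpty (V.tensor W).Occ) : IsEmpty W.Occ :=
  ⟨fun i => h.false (.inr i)⟩

namespace Presented

/-- The canonical map to the unit, for a word without atoms. -/
def blank : ∀ (V : Word A), IsEmpty V.Occ → ((of V : Presented G R) ⟶ 𝟙_ (Presented G R))
  | .atom _, h => (h.false ()).elim
  | .unit, _ => 𝟙 _
  | .tensor V W, h => collapseLeft (blank V (Word.isEmpty_left h)) (blank W (Word.isEmpty_right h))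

theorem isIso_blank : ∀ (V : Word A) (h : IsEmpty V.Occ),
    IsIso (blank V h : (of V : Presented G R) ⟶ 𝟙_ (Presented G R))
  | .atom _, h => (h.false ()).elim
  | .unit, _ => inferInstanceAs (IsIso (𝟙 (𝟙_ (Presented G R))))
  | .tensor V W, h => by
    have := isIso_blank V (Word.isEmpty_left h)
    have := isIso_blank W (Word.isEmpty_right h)
    exact inferInstanceAs (IsIso ((blank V _ ⊗ₘ blank W _) ≫ (λ_ (𝟙_ (Presented G R))).hom))

/-- Generators have an atom in their target, so none can occur here; each structure map commutes
with collapsing to the unit. As `blank` is invertible, parallel morphisms between words without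
atoms are equal. -/
theorem mk_blank (g : ∀ {V W}, G V W → V.Occ → W.Occ) (hg : ∀ {V W}, G V W → Nonempty W.Occ)
    {V W : Word A} (p : Pre G V W) (hV : IsEmpty V.Occ) (hW : IsEmpty W.Occ) :
    (mk p : (of V : Presented G R) ⟶ of W) ≫ blank W hW = blank V hV := by
  induction p with
  | gen x => exact ((not_isEmpty_iff.2 (hg x)) hW).elim
  | id V => exact Category.id_comp _
  | comp f h ihf ihh =>
    -- The intermediate word has no atoms because its atoms map to those of the atomless target.
    have hY := (h.pts (fun _ => Unit) g).isEmpty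
    have h₁ := ihf hV hY
    have h₂ := ihh hY hW
    exact (Category.assoc _ _ _).trans ((congrArg _ h₂).trans h₁)
  | whiskerLeft V f ih =>
    exact (whiskerLeft_collapseLeft _ _ _).trans (congrArg (collapseLeft _) (ih _ _))
  | whiskerRight f Z ih =>
    exact (whiskerRight_collapseLeft _ _ _).trans
      (congrArg (fun k => collapseLeft k _) (ih (Word.isEmpty_left hV) _))
  | assocHom V W Z => exact associator_collapse_right _ _ _
  | assocInv V W Z =>
    exact (Iso.inv_comp_eq (α_ (of V : Presented G R) (of W) (of Z))).2
      (associator_collapse_right _ _ _).symm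
  | leftHom V => exact leftUnitor_collapse _
  | leftInv V =>
    exact (Iso.inv_comp_eq (λ_ (of V : Presented G R))).2 (leftUnitor_collapse _).symm
  | rightHom V =>
    exact (rightUnitor_collapse _).trans (collapseLeft_eq_collapseRight _ _).symm
  | rightInv V =>
    exact (Iso.inv_comp_eq (ρ_ (of V : Presented G R))).2
      ((collapseLeft_eq_collapseRight _ _).trans (rightUnitor_collapse _).symm)
  | braid V W =>
    exact (braiding_collapseLeft _ _).trans (collapseLeft_eq_collapseRight _ _).symm

/-- The canonical map to an atom, for a word in which only that atom occurs, and only once. -/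
def single : ∀ (V : Word A) (i : V.Occ), (∀ j, j = i) → ∀ t : A, V.elim (fun a _ => a) i = t →
    ((of V : Presented G R) ⟶ of (.atom t))
  | .atom _, _, _, _, h => eqToHom (congrArg Word.atom h)
  | .unit, i, _, _, _ => i.elim
  | .tensor V W, .inl i, hi, t, h =>
    collapseRight (single V i (fun j => Sum.inl_injective (hi (.inl j))) t h)
      (blank W ⟨fun j => Sum.inr_ne_inl (hi (.inr j))⟩)
  | .tensor V W, .inr i, hi, t, h =>
    collapseLeft (blank V ⟨fun j => Sum.inl_ne_inr (hi (.inl j))⟩)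
      (single W i (fun j => Sum.inr_injective (hi (.inr j))) t h)

/-- The analogue of `mk_blank` with one surviving atom, in the absence of generators: structure maps
move that atom past factors that collapse to the unit. -/
theorem mk_single (g : ∀ {V W}, G V W → V.Occ → W.Occ) (hg : ∀ {V W}, G V W → False)
    {V W : Word A} (p : Pre G V W) (i : V.Occ) (hi : ∀ j, j = i)
    (hj : ∀ j, j = p.pts (fun _ => Unit) g i) (t : A) (ht ht') :
    (mk p : (of V : Presented G R) ⟶ of W) ≫ single W (p.pts (fun _ => Unit) g i) hj t ht' =
      single V i hi t ht := by
  have hg' : ∀ {V W}, G V W → Nonempty W.Occ := fun x => (hg x).elim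
  induction p with
  | gen x => exact (hg x).elim
  | id V => exact Category.id_comp _
  | @comp V W Z f h ihf ihh =>
    have hk : ∀ j, j = f.pts (fun _ => Unit) g i := fun j => by
      obtain ⟨k, rfl⟩ := (Pre.pts_bijective _ g (fun x => (hg x).elim) f).2 j
      rw [hi k]
    have htk : W.elim (fun a _ => a) (f.pts (fun _ => Unit) g i) = t :=
      (Pre.elim_pts _ _ (fun x => (hg x).elim) f i).trans ht
    exact (Category.assoc _ _ _).trans
      ((congrArg _ (ihh _ hk hj htk ht')).trans (ihf i hi hk ht htk))
  | whiskerLeft V f ih =>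
    rcases i with i | i
    · exact (whiskerLeft_collapseRight _ _ _).trans (congrArg (collapseRight _) (mk_blank g hg' f _ _))
    · exact (whiskerLeft_collapseLeft _ _ _).trans (congrArg (collapseLeft _) (ih _ _ _ _ _))
  | whiskerRight f Z ih =>
    rcases i with i | i
    · exact (whiskerRight_collapseRight _ _ _).trans
        (congrArg (fun k => collapseRight k _) (ih i (fun j => Sum.inl_injective (hi (.inl j))) _ _ _))
    · exact (whiskerRight_collapseLeft _ _ _).trans
        (congrArg (fun k => collapseLeft k _)
          (mk_blank g hg' f ⟨fun j => Sum.inl_ne_inr (hi (.inl j))⟩ _))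
  | assocHom V W Z =>
    rcases i with (i | i) | i
    · exact associator_collapse_left _ _ _
    · exact associator_collapse_middle _ _ _
    · exact associator_collapse_right _ _ _
  | assocInv V W Z =>
    refine (Iso.inv_comp_eq (α_ (of V : Presented G R) (of W) (of Z))).2 ?_
    rcases i with i | (i | i)
    · exact (associator_collapse_left _ _ _).symm
    · exact (associator_collapse_middle _ _ _).symm
    · exact (associator_collapse_right _ _ _).symm
  | leftHom V =>
    rcases i with i | i
    · exact Empty.elim i
    · exact leftUnitor_collapse _
  | leftInv V =>
    exact (Iso.inv_comp_eq (λ_ (of V : Presented G R))).2 (leftUnitor_collapse _).symm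
  | rightHom V =>
    rcases i with i | i
    · exact rightUnitor_collapse _
    · exact Empty.elim i
  | rightInv V =>
    exact (Iso.inv_comp_eq (ρ_ (of V : Presented G R))).2 (rightUnitor_collapse _).symm
  | braid V W =>
    rcases i with i | i
    · exact braiding_collapseLeft _ _
    · exact braiding_collapseRight _ _

end Presented

end Small

/-! ### Faithfulness criterion -/

section Faithful

variable {A : Type u} {G : Word A → Word A → Type v}
  {R : ∀ ⦃V W : Word A⦄, Pre G V W → Pre G V W → Prop}

namespace Presented

theorem splits_hom (g : ∀ {V W}, G V W → V.Occ → W.Occ)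
    (hR : ∀ {V W} {p q : Pre G V W}, R p q → p.pts (fun _ => Unit) g = q.pts (fun _ => Unit) g)
    (hsplit : ∀ {V W : Word A} (x : G V W) (s : W.Occ → Bool),
      Splits (split V (fun i => s (g x i))) (split W s) (mk (.gen x) : (of V : Presented G R) ⟶ of W))
    {V W : Presented G R} (f : V ⟶ W) (s : Word.Occ W → Bool) :
    Splits (split V (fun i => s (pts (fun _ => Unit) g hR f i))) (split W s) f := by
  obtain ⟨p, rfl⟩ := mk_surjective f
  exact splits_mk g hsplit p s

/-- The canonical isomorphism to the unit, for a word without atoms. -/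
noncomputable def blankIso (V : Word A) (h : IsEmpty V.Occ) :
    (of V : Presented G R) ≅ 𝟙_ (Presented G R) :=
  @asIso _ _ _ _ (blank V h) (isIso_blank V h)

/-- The left part of a tensor product. -/
noncomputable def restrTrueIso (V W : Word A) :
    (of ((V.tensor W).restr (Sum.elim (fun _ => true) fun _ => false) true) : Presented G R) ≅
      of V :=
  (eqToIso (restr_const V _ true fun _ => rfl) ⊗ᵢ
    blankIso _ (isEmpty_restr W _ true fun _ => Bool.false_ne_true)) ≪≫ ρ_ (of V)

/-- The right part of a tensor product. -/
noncomputable def restrFalseIso (V W : Word A) :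
    (of ((V.tensor W).restr (Sum.elim (fun _ => true) fun _ => false) false) : Presented G R) ≅
      of W :=
  (blankIso _ (isEmpty_restr V _ false fun _ => Bool.false_ne_true.symm) ⊗ᵢ
    eqToIso (restr_const W _ false fun _ => rfl)) ≪≫ λ_ (of W)

/-- A relation on parallel morphisms that is compatible with composition, reflected by tensor
products and finer than equality of the maps on occurrences of atoms implies equality, if it does
so for morphisms to atoms. -/
theorem eq_of_rel (g : ∀ {V W}, G V W → V.Occ → W.Occ)
    (hR : ∀ {V W} {p q : Pre G V W}, R p q → p.pts (fun _ => Unit) g = q.pts (fun _ => Unit) g)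
    (hne : ∀ {V W}, G V W → Nonempty W.Occ)
    (hsplit : ∀ {V W : Word A} (x : G V W) (s : W.Occ → Bool),
      Splits (split V (fun i => s (g x i))) (split W s) (mk (.gen x) : (of V : Presented G R) ⟶ of W))
    (r : ∀ {V W : Presented G R}, (V ⟶ W) → (V ⟶ W) → Prop)
    (r_pts : ∀ {V W : Presented G R} {f f' : V ⟶ W}, r f f' →
      pts (fun _ => Unit) g hR f = pts (fun _ => Unit) g hR f')
    (r_comp : ∀ {V' V W W' : Presented G R} (h : V' ⟶ V) {f f' : V ⟶ W} (k : W ⟶ W'), r f f' →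
      r (h ≫ f ≫ k) (h ≫ f' ≫ k))
    (r_tensor : ∀ {V V' W W' : Presented G R} {f f' : V ⟶ W} {k k' : V' ⟶ W'},
      r (f ⊗ₘ k) (f' ⊗ₘ k') → r f f' ∧ r k k')
    (r_atom : ∀ {V : Presented G R} {x : A} {f f' : V ⟶ of (.atom x)}, r f f' → f = f')
    {V W : Presented G R} {f f' : V ⟶ W} (h : r f f') : f = f' := by
  have key : ∀ (W : Word A) (V : Presented G R) (f f' : V ⟶ of W), r f f' → f = f' := by
    -- The claim depends on the target only up to isomorphism; the pieces of a split morphism have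
    -- targets that are merely isomorphic to the factors.
    have transport : ∀ {W W' : Presented G R}, (W' ≅ W) →
        (∀ (V : Presented G R) (f f' : V ⟶ W), r f f' → f = f') →
        ∀ {V : Presented G R} {f f' : V ⟶ W'}, r f f' → f = f' := by
      intro W W' e hW V f f' h
      have := hW V (f ≫ e.hom) (f' ≫ e.hom) (by simpa using r_comp (𝟙 V) e.hom h)
      exact (cancel_mono e.hom).1 this
    intro W
    induction W with
    | atom x => exact fun V f f' h => r_atom h
    | unit =>
      intro V f f' _
      have hU : IsEmpty (Word.Occ (.unit : Word A)) := inferInstanceAs (IsEmpty Empty)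
      obtain ⟨p, rfl⟩ := mk_surjective f
      obtain ⟨q, rfl⟩ := mk_surjective f'
      have hV : IsEmpty (Word.Occ V) := (p.pts (fun _ => Unit) g).isEmpty
      have := isIso_blank (G := G) (R := R) _ hU
      rw [← cancel_mono (blank _ hU)]
      exact (mk_blank g hne p hV hU).trans (mk_blank g hne q hV hU).symm
    | tensor W₁ W₂ ih₁ ih₂ =>
      intro V f f' h
      have hf := splits_hom g hR hsplit f (Sum.elim (fun _ => true) fun _ => false)
      have hf' := splits_hom g hR hsplit f' (Sum.elim (fun _ => true) fun _ => false)
      -- Related morphisms pull the colouring back to the same colouring of `V`, so both split along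
      -- the same decomposition of the source.
      rw [← r_pts h] at hf'
      obtain ⟨f₁, f₂, hf⟩ := hf
      obtain ⟨f₁', f₂', hf'⟩ := hf'
      have h' := r_comp (split V fun i => Sum.elim (fun _ => true) (fun _ => false)
        (pts (fun _ => Unit) g hR f i)).inv
        (split (W₁.tensor W₂) (Sum.elim (fun _ => true) fun _ => false)).hom h
      -- Conjugated by the splittings, the two morphisms are tensor products, so the relation passes
      -- to their factors.
      rw [(Iso.inv_comp_eq _).2 hf, (Iso.inv_comp_eq _).2 hf'] at h'
      obtain ⟨h₁, h₂⟩ := r_tensor h'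
      have e₁ := transport (restrTrueIso W₁ W₂) ih₁ h₁
      have e₂ := transport (restrFalseIso W₁ W₂) ih₂ h₂
      rw [e₁, e₂, ← hf'] at hf
      exact (cancel_mono _).1 hf
  exact key W V f f' h

end Presented

end Faithful

/-! ### Coherence for symmetric monoidal categories -/

section Sym

variable {T : Type u}

theorem symPerm_tensor {V V' W W' : FreeSym T} (f : V ⟶ W) (k : V' ⟶ W') :
    symPerm (f ⊗ₘ k) = Sum.map (symPerm f) (symPerm k) := by
  obtain ⟨f, rfl⟩ := Presented.mk_surjective f
  obtain ⟨k, rfl⟩ := Presented.mk_surjective k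
  funext i
  rcases i with i | i <;> rfl

theorem sum_map_injective {α β α' β' : Type*} {f f' : α → β} {k k' : α' → β'}
    (h : Sum.map f k = Sum.map f' k') : f = f' ∧ k = k' :=
  ⟨funext fun i => Sum.inl_injective (congrFun h (.inl i)),
    funext fun i => Sum.inr_injective (congrFun h (.inr i))⟩

/-- The source contains exactly one letter, so every morphism to `x` is the canonical map `single`.
-/
theorem eq_of_symPerm_atom {V : FreeSym T} {x : T} {f f' : V ⟶ Presented.of (.atom x)}
    (h : symPerm f = symPerm f') : f = f' := by
  obtain ⟨p, rfl⟩ := Presented.mk_surjective f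
  obtain ⟨q, rfl⟩ := Presented.mk_surjective f'
  have hx : ∀ (i : Word.Occ (.atom x)) hi ht, Presented.single (G := fun _ _ => PEmpty.{u + 1})
      (R := fun _ _ _ _ => False) (.atom x) i hi x ht = 𝟙 _ := fun _ _ _ => eqToHom_refl _ _
  have key : ∀ p : Pre (fun _ _ : Word T => PEmpty.{u + 1}) V (.atom x), ∀ i, ∀ hi : ∀ j, j = i,
      ∀ ht, (Presented.mk p : Presented.of V ⟶ _) = Presented.single V i hi x ht :=
    fun p i hi ht => ((congrArg _ (hx _ _ _)).trans (Category.comp_id _)).symm.trans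
      (Presented.mk_single (fun e => e.elim) (fun e => e.elim) p i hi (fun _ => rfl) x ht rfl)
  have hp := Pre.pts_bijective (fun _ => Unit) (fun e => e.elim) (fun e => e.elim) p
  obtain ⟨i, -⟩ := hp.2 ()
  -- The target has one occurrence, so any two occurrences in `V` have the same image under an
  -- injective map.
  have hi : ∀ j, j = i := fun j => hp.1 rfl
  have ht := Pre.elim_pts (fun (a : T) (_ : Unit) => a) (fun e => e.elim) (fun e => e.elim) p i
  exact (key p i hi ht.symm).trans (key q i hi ht.symm).symm

/-- Coherence for symmetric monoidal categories: formal morphisms with the same underlying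
permutation are equal. -/
theorem eq_of_symPerm {V W : FreeSym T} {f f' : V ⟶ W} (h : symPerm f = symPerm f') : f = f' :=
  Presented.eq_of_rel (A := T) (G := fun _ _ => PEmpty.{u + 1}) (R := fun _ _ _ _ => False)
    (fun e => e.elim) (fun h => h.elim) (fun e => e.elim) (fun e => e.elim)
    (fun f f' => symPerm f = symPerm f') (fun h => h)
    (fun h f f' k e => by rw [symPerm_comp, symPerm_comp, symPerm_comp, symPerm_comp, e])
    (fun h => by
      rw [symPerm_tensor, symPerm_tensor] at h
      exact sum_map_injective h)
    eq_of_symPerm_atom h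

end Sym

/-! ### Splittings of the structure maps of a lax monoidal functor -/

section SplitsUnitors

variable {D : Type u₂} [Category.{v₂} D] [MonoidalCategory D]

namespace Splits

theorem rightUnitor_symm {V W : D} (f : V ⟶ W) : Splits (ρ_ V).symm (ρ_ W).symm f :=
  ⟨f, 𝟙 _, by simp⟩

theorem leftUnitor_symm {V W : D} (f : V ⟶ W) : Splits (λ_ V).symm (λ_ W).symm f :=
  ⟨𝟙 _, f, by simp⟩

theorem unit_rightUnitor_symm {W : D} (f : 𝟙_ D ⟶ W) : Splits unitDecomp (ρ_ W).symm f :=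
  ⟨f, 𝟙 _, by simp [unitDecomp, unitors_inv_equal]⟩

/-- Both sources get the colour of the target, so one part carries `f` and the other is `I ⊗ I ⟶ I`.
The identity needed is that the right unitor is a monoidal transformation. -/
theorem tensor_rightUnitor_symm [SymmetricCategory D] {V W Z : D} (f : V ⊗ W ⟶ Z) :
    Splits (tensorDecomp (ρ_ V).symm (ρ_ W).symm) (ρ_ Z).symm f := by
  refine ⟨f, (λ_ _).hom, ?_⟩
  simp only [tensorDecomp, Iso.trans_hom, tensorIso_hom, Category.assoc, Iso.symm_hom]
  have h := rightUnitor_monoidal V W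
  have h' : tensorμ V (𝟙_ D) W (𝟙_ D) ≫ (V ⊗ W) ◁ (λ_ (𝟙_ D)).hom =
      ((ρ_ V).hom ⊗ₘ (ρ_ W).hom) ≫ (ρ_ (V ⊗ W)).inv := by
    rw [h]; simp
  rw [MonoidalCategory.tensorHom_def' f, reassoc_of% h', tensorHom_comp_tensorHom_assoc]
  simp

theorem tensor_leftUnitor_symm [SymmetricCategory D] {V W Z : D} (f : V ⊗ W ⟶ Z) :
    Splits (tensorDecomp (λ_ V).symm (λ_ W).symm) (λ_ Z).symm f := by
  refine ⟨(λ_ _).hom, f, ?_⟩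
  simp only [tensorDecomp, Iso.trans_hom, tensorIso_hom, Category.assoc, Iso.symm_hom]
  have h := leftUnitor_monoidal V W
  have h' : tensorμ (𝟙_ D) V (𝟙_ D) W ≫ (λ_ (𝟙_ D)).hom ▷ (V ⊗ W) =
      ((λ_ V).hom ⊗ₘ (λ_ W).hom) ≫ (λ_ (V ⊗ W)).inv := by
    rw [h]; simp
  rw [MonoidalCategory.tensorHom_def _ f, reassoc_of% h', tensorHom_comp_tensorHom_assoc]
  simp

end Splits

end SplitsUnitors

/-! ### Merging all blocks of a word -/

section Squares

variable {C : Type u₁} [Category.{v₁} C] {D : Type u₂} [Category.{v₂} D] {F : C ⥤ D}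
  {V W Z : D} {v w z : C} {a : V ⟶ F.obj v} {b : W ⟶ F.obj w} {c : Z ⟶ F.obj z}

theorem inv_square {f : V ≅ W} {k : v ≅ w} (h : f.hom ≫ b = a ≫ F.map k.hom) :
    f.inv ≫ a = b ≫ F.map k.inv := by
  rw [Iso.inv_comp_eq, reassoc_of% h, ← F.map_comp, Iso.hom_inv_id, F.map_id, Category.comp_id]

theorem comp_square {f : V ⟶ W} {g : W ⟶ Z} {k : v ⟶ w} {l : w ⟶ z} (h : f ≫ b = a ≫ F.map k)
    (h' : g ≫ c = b ≫ F.map l) : (f ≫ g) ≫ c = a ≫ F.map (k ≫ l) := by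
  rw [Category.assoc, h', reassoc_of% h, F.map_comp]

end Squares

section Merge

open Functor.LaxMonoidal

variable {C : Type u₁} [Category.{v₁} C] [MonoidalCategory C]
  {D : Type u₂} [Category.{v₂} D] [MonoidalCategory D] {F : C ⥤ D} [F.LaxMonoidal]

/-- The tensor product of two maps to values of `F`, followed by the composition map of `F`. -/
def mergeHom {V W : D} {v w : C} (a : V ⟶ F.obj v) (b : W ⟶ F.obj w) : V ⊗ W ⟶ F.obj (v ⊗ w) :=
  (a ⊗ₘ b) ≫ μ F v w

variable {V W Z V' W' : D} {v w z v' w' : C}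

/-- This and the following lemmas are the lax symmetric monoidal axioms of `F`, written as the
squares needed for naturality of `merge`. -/
theorem whiskerLeft_mergeHom (a : V ⟶ F.obj v) {f : W ⟶ W'} {b : W ⟶ F.obj w}
    {b' : W' ⟶ F.obj w'} {k : w ⟶ w'} (h : f ≫ b' = b ≫ F.map k) :
    V ◁ f ≫ mergeHom a b' = mergeHom a b ≫ F.map (v ◁ k) := by
  rw [mergeHom, mergeHom, Category.assoc, ← μ_natural_right, ← id_tensorHom, ← id_tensorHom,
    tensorHom_comp_tensorHom_assoc, tensorHom_comp_tensorHom_assoc, h, Category.id_comp,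
    Category.comp_id]

theorem whiskerRight_mergeHom {f : V ⟶ V'} {a : V ⟶ F.obj v} {a' : V' ⟶ F.obj v'} {k : v ⟶ v'}
    (h : f ≫ a' = a ≫ F.map k) (b : W ⟶ F.obj w) :
    f ▷ W ≫ mergeHom a' b = mergeHom a b ≫ F.map (k ▷ w) := by
  rw [mergeHom, mergeHom, Category.assoc, ← μ_natural_left, ← tensorHom_id, ← tensorHom_id,
    tensorHom_comp_tensorHom_assoc, tensorHom_comp_tensorHom_assoc, h, Category.id_comp,
    Category.comp_id]

theorem associator_mergeHom (a : V ⟶ F.obj v) (b : W ⟶ F.obj w) (c : Z ⟶ F.obj z) :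
    (α_ V W Z).hom ≫ mergeHom a (mergeHom b c) =
      mergeHom (mergeHom a b) c ≫ F.map (α_ v w z).hom := by
  have h := associativity F v w z
  calc _ = ((a ⊗ₘ b) ⊗ₘ c) ≫ (α_ _ _ _).hom ≫ F.obj v ◁ μ F w z ≫ μ F v (w ⊗ z) := by
        rw [mergeHom, mergeHom, associator_naturality_assoc, ← id_tensorHom,
          tensorHom_comp_tensorHom_assoc, Category.comp_id]
    _ = _ := by
        rw [← h, mergeHom, mergeHom, ← tensorHom_id, tensorHom_comp_tensorHom_assoc,
          Category.comp_id, Category.assoc]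

theorem leftUnitor_mergeHom (a : V ⟶ F.obj v) :
    (λ_ V).hom ≫ a = mergeHom (ε F) a ≫ F.map (λ_ v).hom := by
  rw [← leftUnitor_naturality, left_unitality, mergeHom, ← id_tensorHom, ← tensorHom_id,
    tensorHom_comp_tensorHom_assoc, Category.id_comp, Category.comp_id, Category.assoc]

theorem rightUnitor_mergeHom (a : V ⟶ F.obj v) :
    (ρ_ V).hom ≫ a = mergeHom a (ε F) ≫ F.map (ρ_ v).hom := by
  rw [← rightUnitor_naturality, right_unitality, mergeHom, ← id_tensorHom, ← tensorHom_id,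
    tensorHom_comp_tensorHom_assoc, Category.id_comp, Category.comp_id, Category.assoc]

theorem mergeHom_id (v w : C) :
    μ F v w ≫ 𝟙 _ = mergeHom (𝟙 (F.obj v)) (𝟙 (F.obj w)) ≫ F.map (𝟙 _) := by
  simp [mergeHom]

theorem braiding_mergeHom [SymmetricCategory C] [SymmetricCategory D] {F : C ⥤ D} [F.LaxBraided]
    (a : V ⟶ F.obj v) (b : W ⟶ F.obj w) :
    (β_ V W).hom ≫ mergeHom b a = mergeHom a b ≫ F.map (β_ v w).hom := by
  rw [mergeHom, mergeHom, Category.assoc, Functor.LaxBraided.braided,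
    BraidedCategory.braiding_naturality_assoc]

end Merge

/-! ### Coherence for lax symmetric monoidal functors -/

section Lax

variable {T : Type u}

open Presented

/-- The values of the generators under the functor forgetting the expressions `F(…)`. -/
def flattenGen : ∀ {V W : Word (FreeSym T)}, LaxGen T V W →
    ((evalObj (fun w => w) V : FreeSym T) ⟶ evalObj (fun w => w) W)
  | _, _, .map f => f
  | _, _, .unit => 𝟙 (𝟙_ (FreeSym T))
  | _, _, .mul w w' => 𝟙 (w ⊗ w')

/-- The strict symmetric monoidal functor forgetting the expressions `F(…)`. -/
def flatten : LaxFree T ⥤ FreeSym T :=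
  Presented.lift (fun w => w) flattenGen (by
    intro V W p q h
    -- With unit and composition maps sent to identities, each relation becomes a trivial identity
    -- in `FreeSym T`.
    induction h <;> simp [evalPre, evalObj, flattenGen])

/-- The canonical map from a word to a single block. -/
def merge : ∀ V : Word (FreeSym T), (of V : LaxFree T) ⟶ (freeLax T).obj (flatten.obj V)
  | .atom _ => 𝟙 _
  | .unit => Functor.LaxMonoidal.ε (freeLax T)
  | .tensor V W => mergeHom (F := freeLax T) (merge V) (merge W)

/-- Merging is a natural transformation from the identity to `flatten ⋙ freeLax T`. Generators are
sent to the obvious squares, and the square of each structure map is an axiom of a lax symmetric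
monoidal functor. -/
theorem merge_naturality {V W : LaxFree T} (f : V ⟶ W) :
    f ≫ merge W = merge V ≫ (freeLax T).map (flatten.map f) := by
  obtain ⟨p, rfl⟩ := mk_surjective f
  induction p with
  | gen x =>
    cases x with
    | map f => exact (Category.comp_id _).trans (Category.id_comp _).symm
    | unit =>
      exact (Category.comp_id _).trans
        ((congrArg _ ((freeLax T).map_id _)).trans (Category.comp_id _)).symm
    | mul w w' => exact mergeHom_id (F := freeLax T) w w'
  | id V =>
    exact (Category.id_comp _).trans
        ((congrArg _ ((freeLax T).map_id _)).trans (Category.comp_id _)).symm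
  | comp f h ihf ihh => exact comp_square (F := freeLax T) ihf ihh
  | whiskerLeft V f ih => exact whiskerLeft_mergeHom (F := freeLax T) _ ih
  | whiskerRight f Z ih => exact whiskerRight_mergeHom (F := freeLax T) ih _
  | assocHom V W Z => exact associator_mergeHom (F := freeLax T) _ _ _
  | assocInv V W Z =>
    exact inv_square (F := freeLax T) (k := α_ _ _ _) (associator_mergeHom (F := freeLax T) _ _ _)
  | leftHom V => exact leftUnitor_mergeHom (F := freeLax T) _
  | leftInv V =>
    exact inv_square (F := freeLax T) (k := λ_ _) (leftUnitor_mergeHom (F := freeLax T) _)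
  | rightHom V => exact rightUnitor_mergeHom (F := freeLax T) _
  | rightInv V =>
    exact inv_square (F := freeLax T) (k := ρ_ _) (rightUnitor_mergeHom (F := freeLax T) _)
  | braid V W => exact braiding_mergeHom (F := freeLax T) _ _

theorem letterMap_comp {V W Z : LaxFree T} (f : V ⟶ W) (g : W ⟶ Z) :
    letterMap (f ≫ g) = letterMap g ∘ letterMap f := by
  obtain ⟨f, rfl⟩ := mk_surjective f
  obtain ⟨g, rfl⟩ := mk_surjective g
  rfl

theorem blockMap_comp {V W Z : LaxFree T} (f : V ⟶ W) (g : W ⟶ Z) :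
    blockMap (f ≫ g) = blockMap g ∘ blockMap f := by
  obtain ⟨f, rfl⟩ := mk_surjective f
  obtain ⟨g, rfl⟩ := mk_surjective g
  rfl

theorem letterMap_tensor {V V' W W' : LaxFree T} (f : V ⟶ W) (k : V' ⟶ W') :
    letterMap (f ⊗ₘ k) = Sum.map (letterMap f) (letterMap k) := by
  obtain ⟨f, rfl⟩ := mk_surjective f
  obtain ⟨k, rfl⟩ := mk_surjective k
  funext i
  rcases i with i | i <;> rfl

theorem blockMap_tensor {V V' W W' : LaxFree T} (f : V ⟶ W) (k : V' ⟶ W') :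
    blockMap (f ⊗ₘ k) = Sum.map (blockMap f) (blockMap k) := by
  obtain ⟨f, rfl⟩ := mk_surjective f
  obtain ⟨k, rfl⟩ := mk_surjective k
  funext i
  rcases i with i | i <;> rfl

/-- A single block merges by the identity, so naturality factors any morphism to it as `merge V`
followed by `F` of its flattening. This reduces the claim to coherence in `FreeSym T`. -/
theorem eq_of_letterMap_atom {V : LaxFree T} {w : FreeSym T} {f f' : V ⟶ of (.atom w)}
    (h : letterMap f = letterMap f') : f = f' := by
  have key : ∀ k : V ⟶ of (.atom w), k = merge V ≫ (freeLax T).map (flatten.map k) := fun k =>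
    (Category.comp_id k).symm.trans (merge_naturality k)
  have hk : ∀ k : V ⟶ of (.atom w), letterMap k = symPerm (flatten.map k) ∘ letterMap (merge V) :=
    fun k => (congrArg letterMap (key k)).trans (letterMap_comp _ _)
  rw [hk f, hk f'] at h
  -- The letter map of `merge V` is surjective and can be cancelled.
  have e := eq_of_symPerm ((letterMap_bijective (merge V)).2.injective_comp_right h)
  exact (key f).trans
    ((congrArg (fun k => merge V ≫ (freeLax T).map k) e).trans (key f').symm)

/-- The target of a generator is one block, so the pulled-back colouring is constant: the generator
acts in one part, and a structure map of units in the other. -/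
theorem splits_laxGen {V W : Word (FreeSym T)} (x : LaxGen T V W) (s : W.Occ → Bool) :
    Splits (split V (fun i => s (genSupp x i))) (split W s) (mk (.gen x) : (of V : LaxFree T) ⟶ of W) := by
  cases x with
  | map f =>
    change Splits (splitAtom _ (s ())) (splitAtom _ (s ())) _
    cases s ()
    · exact Splits.leftUnitor_symm _
    · exact Splits.rightUnitor_symm _
  | unit =>
    change Splits unitDecomp (splitAtom _ (s ())) _
    cases s ()
    · exact Splits.leftUnitor_symm _
    · exact Splits.unit_rightUnitor_symm _
  | mul w w' =>
    change Splits (tensorDecomp (splitAtom _ (s ())) (splitAtom _ (s ()))) (splitAtom _ (s ())) _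
    cases s ()
    · exact Splits.tensor_leftUnitor_symm _
    · exact Splits.tensor_rightUnitor_symm _

theorem genSupp_rel {V W : Word (FreeSym T)} {p q : Pre (LaxGen T) V W} (h : LaxRel T p q) :
    p.pts (fun _ => Unit) genSupp = q.pts (fun _ => Unit) genSupp := by
  induction h with
  | unit_left w => funext x; rcases x with x | x; exacts [Empty.elim x, rfl]
  | unit_right w => funext x; rcases x with x | x; exacts [rfl, Empty.elim x]
  | _ => rfl

theorem nonempty_of_laxGen {V W : Word (FreeSym T)} (x : LaxGen T V W) : Nonempty W.Occ := by
  cases x <;> exact ⟨()⟩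

/-- Coherence for lax symmetric monoidal functors: formal morphisms that induce the same maps on
letters and blocks are equal. -/
theorem eq_of_letterMap_blockMap {V W : LaxFree T} {f f' : V ⟶ W}
    (h : letterMap f = letterMap f') (h' : blockMap f = blockMap f') : f = f' :=
  Presented.eq_of_rel genSupp genSupp_rel nonempty_of_laxGen splits_laxGen
    (fun f f' => letterMap f = letterMap f' ∧ blockMap f = blockMap f') (fun h => h.2)
    (fun h f f' k e => by simp only [letterMap_comp, blockMap_comp, e.1, e.2, and_self])
    (fun h => by
      rw [letterMap_tensor, letterMap_tensor, blockMap_tensor, blockMap_tensor] at h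
      exact ⟨⟨(sum_map_injective h.1).1, (sum_map_injective h.2).1⟩,
        (sum_map_injective h.1).2, (sum_map_injective h.2).2⟩)
    (fun h => eq_of_letterMap_atom h.1) ⟨h, h'⟩

/-- The left-to-right numberings are bijections, so equality of the numbered maps gives equality of
the maps on letters and blocks. -/
theorem SameShape.eq {V W : LaxFree T} {f f' : V ⟶ W} (h : SameShape f f') : f = f' := by
  refine eq_of_letterMap_blockMap (funext fun i => ?_) (funext fun i => ?_)
  · have := DFunLike.congr_fun h.2 (letterEnum V i)
    simpa [underlyingPerm] using this
  · have := congrFun h.1 ⟨blockEnum V i⟩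
    have := (blockEnum W).injective (congrArg ULift.down this)
    simpa using this

end Lax

/-! ### Formal diagrams -/

section Diagrams

variable {J : Type w₁} [Quiver.{w₂} J]

theorem composePath_mapPath {E : Type u₁} [Category.{v₁} E] {D : Type u₂} [Category.{v₂} D]
    (l : J ⥤q E) (F : E ⥤ D) {a b : J} (p : Quiver.Path a b) :
    composePath ((l ⋙q F.toPrefunctor).mapPath p) = F.map (composePath (l.mapPath p)) := by
  induction p with
  | nil => exact (F.map_id _).symm
  | cons p e ih => exact (congrArg (fun k => k ≫ _) ih).trans (F.map_comp _ _).symm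

theorem commutes_of_lift {E : Type u₁} [Category.{v₁} E] {D : Type u₂} [Category.{v₂} D]
    (l : J ⥤q E) (F : E ⥤ D) (h : Commutes l) : Commutes (l ⋙q F.toPrefunctor) := fun a b p q => by
  rw [composePath_mapPath, composePath_mapPath, h p q]

variable {C : Type u₁} [Category.{v₁} C] [MonoidalCategory C] [SymmetricCategory C]
  {D : Type u₂} [Category.{v₂} D] [MonoidalCategory D] [SymmetricCategory D]

theorem LaxExpectedToCommute.commutes {F : C ⥤ D} [F.LaxBraided] {d : J ⥤q D}
    (h : LaxExpectedToCommute F d) : Commutes d := by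
  obtain ⟨l, rfl, hl⟩ := h
  exact commutes_of_lift l _ fun a b p q => (hl p q).eq

theorem OplaxExpectedToCommute.commutes {F : C ⥤ D} [OplaxSymmetric F] {d : J ⥤q D}
    (h : OplaxExpectedToCommute F d) : Commutes d := by
  obtain ⟨l, rfl, hl⟩ := h
  exact commutes_of_lift l _ fun a b p q => Quiver.Hom.unop_inj (hl p q).eq

end Diagrams

/-! ### Existence of formal morphisms -/

section Existence

variable {A : Type u} {G : Word A → Word A → Type v}
  {R : ∀ ⦃V W : Word A⦄, Pre G V W → Pre G V W → Prop}

theorem exists_sum_map {α β α' β' : Type*} (f : α ⊕ β → α' ⊕ β')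
    (hf : ∀ i, (f i).isLeft = i.isLeft) : ∃ f₁ f₂, f = Sum.map f₁ f₂ := by
  have h₁ : ∀ i, ∃ j, f (.inl i) = .inl j := fun i => Sum.isLeft_iff.1 (hf (.inl i))
  have h₂ : ∀ i, ∃ j, f (.inr i) = .inr j := fun i =>
    Sum.isRight_iff.1 (by simpa using hf (.inr i))
  choose f₁ h₁ using h₁
  choose f₂ h₂ using h₂
  refine ⟨f₁, f₂, funext fun i => ?_⟩
  rcases i with i | i
  exacts [h₁ i, h₂ i]

namespace Presented

/-! ### Functoriality of the action on points -/

section Pts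

variable (B : A → Type) (g : ∀ {V W}, G V W → V.Pts B → W.Pts B)
  (hR : ∀ {V W} {p q : Pre G V W}, R p q → p.pts B g = q.pts B g)

theorem pts_comp {V W Z : Presented G R} (f : V ⟶ W) (k : W ⟶ Z) :
    pts B g hR (f ≫ k) = pts B g hR k ∘ pts B g hR f := by
  obtain ⟨f, rfl⟩ := mk_surjective f
  obtain ⟨k, rfl⟩ := mk_surjective k
  rfl

theorem pts_tensor {V V' W W' : Presented G R} (f : V ⟶ W) (k : V' ⟶ W') :
    pts B g hR (f ⊗ₘ k) = Sum.map (pts B g hR f) (pts B g hR k) := by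
  obtain ⟨f, rfl⟩ := mk_surjective f
  obtain ⟨k, rfl⟩ := mk_surjective k
  funext i
  rcases i with i | i <;> rfl

theorem pts_inv_hom {V W : Presented G R} (f : V ≅ W) (i) :
    pts B g hR f.inv (pts B g hR f.hom i) = i := by
  rw [← Function.comp_apply (f := pts B g hR f.inv), ← pts_comp, Iso.hom_inv_id]; rfl

theorem pts_hom_inv {V W : Presented G R} (f : V ≅ W) (i) :
    pts B g hR f.hom (pts B g hR f.inv i) = i := pts_inv_hom B g hR f.symm i

end Pts

/-- The splitting of a word sends the occurrences of atoms to the parts given by their colours. -/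
theorem isLeft_split (g : ∀ {V W}, G V W → V.Occ → W.Occ)
    (hR : ∀ {V W} {p q : Pre G V W}, R p q → p.pts (fun _ => Unit) g = q.pts (fun _ => Unit) g) :
    ∀ (V : Word A) (s : V.Occ → Bool) (i : V.Occ),
      Sum.isLeft (pts (fun _ => Unit) g hR (split V s : (of V : Presented G R) ≅ _).hom i) = s i
  | .atom x, s, i => by
    change Sum.isLeft (pts (fun _ => Unit) g hR (splitAtom x (s ())).hom i) = s ()
    cases s () <;> rfl
  | .unit, s, i => i.elim
  | .tensor V W, s, i => by
    -- The interchange regroups four summands by colour, so the side on which an occurrence ends is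
    -- its side in its own factor.
    have key : ∀ (V₁ V₂ W₁ W₂ : Word A) (i : (V₁.Occ ⊕ V₂.Occ) ⊕ (W₁.Occ ⊕ W₂.Occ)),
        Sum.isLeft (α := V₁.Occ ⊕ W₁.Occ) (β := V₂.Occ ⊕ W₂.Occ)
          (pts (fun _ => Unit) g hR (tensorμ (of V₁ : Presented G R) (of V₂) (of W₁) (of W₂)) i) =
        Sum.elim Sum.isLeft Sum.isLeft i := by
      intro V₁ V₂ W₁ W₂ i
      rcases i with (i | i) | (i | i) <;> rfl
    refine (congrArg Sum.isLeft (congrFun (pts_comp _ g hR (_ ⊗ₘ _) (tensorμ _ _ _ _)) i)).trans ?_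
    refine (key _ _ _ _ _).trans ?_
    refine (congrArg (Sum.elim Sum.isLeft Sum.isLeft) (congrFun (pts_tensor _ g hR _ _) i)).trans ?_
    rcases i with i | i
    · exact isLeft_split g hR V _ i
    · exact isLeft_split g hR W _ i

end Presented

/-! ### Morphisms and words with prescribed letters and blocks -/

variable {T : Type u}

open Presented

theorem symPerm_hom_inv {V W : FreeSym T} (f : V ≅ W) (i : SymLetter W) :
    symPerm f.hom (symPerm f.inv i) = i :=
  pts_hom_inv (A := T) (G := fun _ _ => PEmpty.{u + 1}) (R := fun _ _ _ _ => False) _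
    (fun e => e.elim) (fun h => h.elim) f i

theorem isLeft_symPerm_split (V : Word T) (s : V.Occ → Bool) (i : V.Occ) :
    Sum.isLeft (symPerm (split V s : (of V : FreeSym T) ≅ _).hom i) = s i :=
  isLeft_split (A := T) (G := fun _ _ => PEmpty.{u + 1}) (R := fun _ _ _ _ => False)
    (fun e => e.elim) (fun h => h.elim) V s i

/-- There is a formal morphism between words of the free symmetric monoidal category in which the
same letters occur. -/
theorem nonempty_hom_of_symLetter (W : Word T) : ∀ (V : FreeSym T) (σ : SymLetter V → SymLetter W),
    Function.Bijective σ → (∀ i, symLabel W (σ i) = symLabel V i) →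
    Nonempty (V ⟶ (of W : FreeSym T)) := by
  induction W with
  | atom t =>
    intro V σ hσ hl
    obtain ⟨i, -⟩ := hσ.2 ()
    exact ⟨single V i (fun j => hσ.1 rfl) t (hl i).symm⟩
  | unit =>
    intro V σ _ _
    exact ⟨blank V ⟨fun i => Empty.elim (σ i)⟩⟩
  | tensor W₁ W₂ ih₁ ih₂ =>
    intro V σ hσ hl
    -- Each letter is coloured by the factor of the target into which `σ` sends it, so `σ` becomes a
    -- sum of two bijections after splitting.
    let d : V ≅ _ := split V fun i => Sum.isLeft (σ i)
    have hd : ∀ i, symPerm d.hom (symPerm d.inv i) = i :=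
      symPerm_hom_inv d
    obtain ⟨τ₁, τ₂, hτ⟩ := exists_sum_map (fun i => σ (symPerm d.inv i)) fun i =>
      (isLeft_symPerm_split V _ (symPerm d.inv i)).symm.trans (congrArg Sum.isLeft (hd i))
    have hb := hσ.comp (symPerm_bijective d.inv)
    have hb' : Function.Bijective (Sum.map τ₁ τ₂) := hτ ▸ hb
    have hl' : ∀ i, symLabel (W₁.tensor W₂) (Sum.map τ₁ τ₂ i) = symLabel (Word.tensor _ _) i :=
      fun i => (congrArg _ (congrFun hτ i).symm).trans ((hl _).trans (symLabel_symPerm d.inv i))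
    obtain ⟨f₁⟩ := ih₁ _ τ₁ (Sum.map_bijective.1 hb').1 fun i => hl' (.inl i)
    obtain ⟨f₂⟩ := ih₂ _ τ₂ (Sum.map_bijective.1 hb').2 fun i => hl' (.inr i)
    exact ⟨d.hom ≫ (f₁ ⊗ₘ f₂)⟩

/-- A map of blocks that is compatible with a label preserving bijection of letters is induced by a
formal morphism. -/
theorem exists_blockMap_eq (W : Word (FreeSym T)) : ∀ (V : LaxFree T) (σ : Letter V → Letter W)
    (h : Block V → Block W), Function.Bijective σ → (∀ i, label W (σ i) = label V i) →
    (∀ i, blockOf W (σ i) = h (blockOf V i)) →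
    ∃ f : V ⟶ (of W : LaxFree T), blockMap f = h := by
  induction W with
  | atom w =>
    intro V σ h hσ hl hb
    let e := Equiv.ofBijective _ (letterMap_bijective (merge V))
    -- After merging, only a rearrangement of letters inside `F` remains; the block map to a single
    -- block carries no further condition.
    obtain ⟨k⟩ := nonempty_hom_of_symLetter w (flatten.obj V) (fun i => σ (e.symm i))
      (hσ.comp e.symm.bijective) fun i => (hl _).trans
        ((label_letterMap (merge V) (e.symm i)).symm.trans
          (congrArg (label (of (.atom (flatten.obj V)))) (e.apply_symm_apply i)))
    exact ⟨merge V ≫ (freeLax T).map k, funext fun _ => rfl⟩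
  | unit =>
    intro V σ h _ _ _
    have hV : IsEmpty (Word.Occ V) := ⟨fun i => Empty.elim (h i)⟩
    exact ⟨blank V hV, funext fun i => hV.elim i⟩
  | tensor W₁ W₂ ih₁ ih₂ =>
    intro V σ h hσ hl hb
    -- Blocks, not letters, are coloured: a block may be empty, and it must go as a whole to the
    -- factor chosen by `h`.
    let d : V ≅ _ := split V fun i => Sum.isLeft (h i)
    have hd : ∀ i, blockMap d.hom (blockMap d.inv i) = i := pts_hom_inv _ _ genSupp_rel d
    have hd' : ∀ i, blockMap d.inv (blockMap d.hom i) = i := pts_inv_hom _ _ genSupp_rel d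
    have hs : ∀ i, Sum.isLeft (h (blockMap d.inv i)) = Sum.isLeft i := fun i =>
      (isLeft_split _ genSupp_rel V _ (blockMap d.inv i)).symm.trans (congrArg Sum.isLeft (hd i))
    obtain ⟨h₁, h₂, hh⟩ := exists_sum_map (fun i => h (blockMap d.inv i)) hs
    have hB : ∀ i, blockOf (W₁.tensor W₂) (σ (letterMap d.inv i)) =
        h (blockMap d.inv (blockOf (Word.tensor _ _) i)) := fun i =>
      (hb _).trans (congrArg h (blockOf_letterMap d.inv i))
    have isLeft_blockOf : ∀ (V W : Word (FreeSym T)) (i : Letter (V.tensor W)),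
        Sum.isLeft (blockOf (V.tensor W) i) = Sum.isLeft i := by
      intro V W i
      rcases i with i | i <;> rfl
    -- A letter lies on the side of its block, so compatibility of `σ` with `h` makes `σ` respect
    -- the splitting as well.
    obtain ⟨τ₁, τ₂, hτ⟩ := exists_sum_map (fun i => σ (letterMap d.inv i)) fun i =>
      (isLeft_blockOf _ _ _).symm.trans ((congrArg Sum.isLeft (hB i)).trans
        ((hs _).trans (isLeft_blockOf _ _ _)))
    have hb' : Function.Bijective (Sum.map τ₁ τ₂) := hτ ▸ hσ.comp (letterMap_bijective d.inv)
    have hl' : ∀ i, label (W₁.tensor W₂) (Sum.map τ₁ τ₂ i) = label (Word.tensor _ _) i :=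
      fun i => (congrArg _ (congrFun hτ i).symm).trans ((hl _).trans (label_letterMap d.inv i))
    have hB' : ∀ i, blockOf (W₁.tensor W₂) (Sum.map τ₁ τ₂ i) =
        Sum.map h₁ h₂ (blockOf (Word.tensor _ _) i) := fun i =>
      (congrArg _ (congrFun hτ i).symm).trans ((hB i).trans (congrFun hh _))
    obtain ⟨f₁, hf₁⟩ := ih₁ _ τ₁ h₁ (Sum.map_bijective.1 hb').1 (fun i => hl' (.inl i))
      fun i => Sum.inl_injective (hB' (.inl i))
    obtain ⟨f₂, hf₂⟩ := ih₂ _ τ₂ h₂ (Sum.map_bijective.1 hb').2 (fun i => hl' (.inr i))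
      fun i => Sum.inr_injective (hB' (.inr i))
    refine ⟨d.hom ≫ (f₁ ⊗ₘ f₂), (blockMap_comp _ _).trans (funext fun i => ?_)⟩
    have hf := (blockMap_tensor f₁ f₂).trans (congrArg₂ Sum.map hf₁ hf₂)
    exact (congrFun hf _).trans <| (congrFun hh (blockMap d.hom i)).symm.trans (congrArg h (hd' i))

/-- A word whose sequence of atoms is `a`. -/
theorem exists_word_of_atoms : ∀ {k : ℕ} (a : Fin k → A), ∃ (V : Word A)
    (pt : ∀ (B : A → Type) (j : Fin k), B (a j) → V.Pts B),
    (∀ B, Function.Bijective fun p : Σ j, B (a j) => pt B p.1 p.2) ∧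
    (∀ (B : A → Type) (S : Type u₁) (l : ∀ x, B x → S) j y, V.elim l (pt B j y) = l (a j) y) ∧
    (∀ (B B' : A → Type) (h : ∀ x, B x → B' x) j y, V.mapPts h (pt B j y) = pt B' j (h _ y))
  | 0, a => ⟨.unit, fun _ j => j.elim0,
      fun _ => ⟨fun p => p.1.elim0, fun i => Empty.elim i⟩, fun _ _ _ j => j.elim0,
      fun _ _ _ j => j.elim0⟩
  | k + 1, a => by
    obtain ⟨V, pt, h₁, h₂, h₃⟩ := exists_word_of_atoms fun j : Fin k => a j.succ
    -- The word is a right-nested tensor product ending in the unit. Points are described uniformly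
    -- in `B`, so that one word serves for both letters and blocks.
    refine ⟨.tensor (.atom (a 0)) V, fun B => Fin.cases (fun y => .inl y) fun j y => .inr (pt B j y),
      fun B => ⟨?_, ?_⟩, fun B S l j => ?_, fun B B' h j => ?_⟩
    · rintro ⟨j, y⟩ ⟨j', y'⟩ h
      induction j using Fin.cases with
      | zero =>
        induction j' using Fin.cases with
        | zero => exact congrArg _ (Sum.inl_injective h)
        | succ j' => exact (Sum.inl_ne_inr h).elim
      | succ j =>
        induction j' using Fin.cases with
        | zero => exact (Sum.inr_ne_inl h).elim
        | succ j' =>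
          have := @(h₁ B).1 ⟨j, y⟩ ⟨j', y'⟩ (Sum.inr_injective h)
          cases this
          rfl
    · rintro (y | i)
      · exact ⟨⟨0, y⟩, rfl⟩
      · obtain ⟨⟨j, y⟩, rfl⟩ := (h₁ B).2 i
        exact ⟨⟨j.succ, y⟩, rfl⟩
    · induction j using Fin.cases with
      | zero => exact fun _ => rfl
      | succ j => exact h₂ B S l j
    · induction j using Fin.cases with
      | zero => exact fun _ => rfl
      | succ j => exact fun y => congrArg Sum.inr (h₃ B B' h j y)

/-- A word of the free symmetric monoidal category with given letters. -/
theorem exists_word_of_letters {S : Type} [Finite S] (X : S → T) : ∃ (w : FreeSym T)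
    (q : S → SymLetter w), Function.Bijective q ∧ ∀ i, symLabel w (q i) = X i := by
  obtain ⟨m, ⟨e⟩⟩ := Finite.exists_equiv_fin S
  obtain ⟨V, pt, h₁, h₂, -⟩ := exists_word_of_atoms (fun j => X (e.symm j))
  refine ⟨V, fun i => pt _ (e i) (), ?_, fun i => ?_⟩
  · exact (h₁ fun _ => Unit).comp
      (e.trans (Equiv.sigmaUnique (Fin m) fun _ => Unit).symm).bijective
  · exact (h₂ _ T (fun t _ => t) _ _).trans (congrArg X (e.symm_apply_apply i))

/-- A word of `LaxFree T` with given letters and blocks. -/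
theorem exists_word_of_map {n k : ℕ} (X : Fin n → T) (φ : Fin n → Fin k) : ∃ (V : LaxFree T)
    (e : Fin n ≃ Letter V) (b : Fin k ≃ Block V), (∀ i, label V (e i) = X i) ∧
    ∀ i, blockOf V (e i) = b (φ i) := by
  -- Block `j` contains the letters of the fibre of `φ` over `j`; an empty fibre still gives a
  -- block.
  choose w q hq hl using fun j => exists_word_of_letters fun i : {i // φ i = j} => X i
  obtain ⟨V, pt, h₁, h₂, h₃⟩ := exists_word_of_atoms w
  refine ⟨V, (Equiv.sigmaFiberEquiv φ).symm.trans
    ((Equiv.sigmaCongrRight fun j => Equiv.ofBijective _ (hq j)).trans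
      (Equiv.ofBijective _ (h₁ SymLetter))),
    (Equiv.sigmaUnique (Fin k) fun _ => Unit).symm.trans (Equiv.ofBijective _ (h₁ fun _ => Unit)),
    fun i => ?_, fun i => ?_⟩
  · exact (h₂ SymLetter T symLabel _ _).trans (hl _ _)
  · exact h₃ SymLetter (fun _ => Unit) (fun _ _ => ()) _ _

end Existence

/-! ### The supporting set functor is an equivalence -/

section Support

variable {T : Type u} {n : ℕ} {X : Fin n → T}

/-- Both words map to their merges, and `F` of a rearrangement of letters connects the merges: `V ⟶
F(v) ⟶ F(w) ⟵ W`. -/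
theorem HasLetters.zigzag {V W : LaxFree T} (hV : HasLetters X V) (hW : HasLetters X W) :
    Zigzag V W := by
  let v := Equiv.ofBijective _ (letterMap_bijective (merge V))
  let w := Equiv.ofBijective _ (letterMap_bijective (merge W))
  let σ : SymLetter (flatten.obj V) ≃ SymLetter (flatten.obj W) :=
    v.symm.trans ((place hV).symm.trans ((place hW).trans w))
  obtain ⟨k⟩ := nonempty_hom_of_symLetter (flatten.obj W) (flatten.obj V) σ σ.bijective fun i => by
    have h₁ := label_letterMap (merge V) (v.symm i)
    have h₂ := label_letterMap (merge W) (place hW ((place hV).symm (v.symm i)))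
    refine h₂.trans ((label_place hW _).trans ((label_place hV _).symm.trans ?_))
    rw [(place hV).apply_symm_apply]
    exact h₁.symm.trans (congrArg (label (Presented.of (.atom (flatten.obj V))))
      (v.apply_symm_apply i))
  exact (Zigzag.of_hom (merge V ≫ (freeLax T).map k)).trans (Zigzag.of_inv (merge W))

variable (hX : Function.Injective X) (W : LaxFree T) (hW : HasLetters X W)

theorem eq_of_label_eq (hX : Function.Injective X) {V : LaxFree T} (hV : HasLetters X V) {i j : Letter V}
    (h : label V i = label V j) : i = j := by
  obtain ⟨i, rfl⟩ := (place hV).surjective i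
  obtain ⟨j, rfl⟩ := (place hV).surjective j
  rw [label_place, label_place] at h
  rw [hX h]

/-- Since labels are preserved and distinct, the letter maps agree automatically; the functor
records the block maps. -/
theorem supportingSet_faithful : (supportingSet X hX W hW).Faithful where
  map_injective {V V'} f f' h := by
    apply ObjectProperty.hom_ext
    apply eq_of_letterMap_blockMap
    · funext i
      exact eq_of_label_eq hX (hW.of_comp V')
        ((label_letterMap _ _).trans (label_letterMap _ _).symm)
    · funext i
      have h₁ := congrFun (congrArg (fun k => k.right) h) ⟨blockEnum V.obj i⟩
      have h₂ := (blockEnum V'.obj).injective (congrArg ULift.down h₁)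
      simpa using h₂

theorem supportingSet_full : (supportingSet X hX W hW).Full where
  map_surjective {V V'} m := by
    have hV := hW.of_comp V
    have hV' := hW.of_comp V'
    let σ := (place hV).symm.trans (place hV')
    obtain ⟨f, hf⟩ := exists_blockMap_eq V'.obj V.obj σ
      (fun i => (blockEnum V'.obj).symm (m.right ⟨blockEnum V.obj i⟩).down) σ.bijective
      (fun i => by
        refine (label_place hV' _).trans ((label_place hV _).symm.trans ?_)
        rw [(place hV).apply_symm_apply])
      (fun i => by
        obtain ⟨i, rfl⟩ := (place hV).surjective i
        refine (Equiv.eq_symm_apply _).2 ?_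
        -- The triangle under `n` says exactly that the block map sends the block of each letter to
        -- the block of its image.
        have := congrArg ULift.down (congrFun (Under.w m) ⟨i⟩)
        refine Eq.trans ?_ this.symm
        change blockEnum V'.obj (blockOf V'.obj (place hV' ((place hV).symm (place hV i)))) = _
        rw [(place hV).symm_apply_apply]
        rfl)
    refine ⟨ObjectProperty.homMk f, ?_⟩
    ext : 1
    funext j
    refine congrArg ULift.up ?_
    change blockEnum V'.obj (blockMap f ((blockEnum V.obj).symm j.down)) = (m.right j).down
    rw [hf]
    exact ((blockEnum V'.obj).apply_symm_apply _).trans (congrArg (fun k => (m.right k).down)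
      (congrArg ULift.up ((blockEnum V.obj).apply_symm_apply j.down)))

theorem supportingSet_essSurj : (supportingSet X hX W hW).EssSurj where
  mem_essImage Y := by
    obtain ⟨V, e, b, he, hb⟩ := exists_word_of_map X
      fun i => ((Y.hom : ULift (Fin n) → ULift (Fin Y.right.len)) ⟨i⟩).down
    have hV : HasLetters X V := ⟨e, he⟩
    let V' : ComponentOf W := ⟨V, Quotient.sound' (hV.zigzag hW)⟩
    let c := b.trans (blockEnum V)
    let ι : Y.right ≅ supportMap.obj V :=
      { hom := fun j => ⟨c j.down⟩
        inv := fun j => ⟨c.symm j.down⟩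
        hom_inv_id := funext fun j => congrArg ULift.up (c.symm_apply_apply j.down)
        inv_hom_id := funext fun j => congrArg ULift.up (c.apply_symm_apply j.down) }
    refine ⟨V', ⟨(Under.isoMk ι (funext fun i => congrArg ULift.up ?_)).symm⟩⟩
    change blockEnum V (b (Y.hom i).down) = blockEnum V (blockOf V (place (hW.of_comp V') i.down))
    -- `place` is an arbitrary choice, but distinctness of the letters forces it to be the
    -- enumeration `e` of the constructed word.
    have hp : place (hW.of_comp V') i.down = e i.down :=
      eq_of_label_eq hX hV ((label_place (hW.of_comp V') _).trans (he _).symm)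
    exact congrArg (blockEnum V) ((hb i.down).symm.trans (congrArg (blockOf V) hp.symm))

theorem supportingSet_isEquivalence : (supportingSet X hX W hW).IsEquivalence where
  faithful := supportingSet_faithful hX W hW
  full := supportingSet_full hX W hW
  essSurj := supportingSet_essSurj hX W hW

end Support

end SymCoherence

theorem mainTheorem6 :
    -- every formal diagram of a lax symmetric monoidal functor that is expected to commute commutes
    (∀ {C : Type u₁} [Category.{v₁} C] [MonoidalCategory C] [SymmetricCategory C]
      {D : Type u₂} [Category.{v₂} D] [MonoidalCategory D] [SymmetricCategory D]
      (F : C ⥤ D) [F.LaxBraided] {J : Type w₁} [Quiver.{w₂} J] (d : J ⥤q D),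
      SymCoherence.LaxExpectedToCommute F d → SymCoherence.Commutes d) ∧
    -- the same for oplax symmetric monoidal functors
    (∀ {C : Type u₁} [Category.{v₁} C] [MonoidalCategory C] [SymmetricCategory C]
      {D : Type u₂} [Category.{v₂} D] [MonoidalCategory D] [SymmetricCategory D]
      (F : C ⥤ D) [SymCoherence.OplaxSymmetric F] {J : Type w₁} [Quiver.{w₂} J] (d : J ⥤q D),
      SymCoherence.OplaxExpectedToCommute F d → SymCoherence.Commutes d) ∧
    -- for distinct letters the supporting set functor to `(n ↓ Fin)` is an equivalence
    (∀ {T : Type u} {n : ℕ} (X : Fin n → T) (hX : Function.Injective X)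
      (W : SymCoherence.LaxFree T) (hW : SymCoherence.HasLetters X W),
      (SymCoherence.supportingSet X hX W hW).IsEquivalence ∧
      (SymCoherence.supportingSet X hX W hW).op.IsEquivalence) := by
  refine ⟨?_, ?_, ?_⟩
  · intro C _ _ _ D _ _ _ F _ J _ d h
    exact h.commutes
  · intro C _ _ _ D _ _ _ F _ J _ d h
    exact h.commutes
  · intro T n X hX W hW
    have := SymCoherence.supportingSet_isEquivalence hX W hW
    -- The opposite of an equivalence is an equivalence.
    exact ⟨this, inferInstance⟩
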